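/- Operators are bounded linear operators between complex Banach spaces; $B_Z$ is the closed unit ball of $Z$; $\mathcal H(E,F)$ is the set of holomorphic mappings $E\to F$. An operator ideal $\mathcal U$, with components $\mathcal U(E,F)$, is \emph{closed} if every $\mathcal U(E,F)$ is closed in the operator norm; \emph{surjective} if $T\in\mathcal U$ whenever $Tq\in\mathcal U$ for some surjective operator $q$; and \emph{factorizable} if every $T\in\mathcal U(E,F)$ can be written $T=jk$ with operators $k:E\to Y$, $j:Y\to F$ and a Banach space $Y$ whose identity $I_Y$ belongs to $\mathcal U$. Let $\mathcal C_{\mathcal U}(F)$ be the collection of all $A\subseteq F$ such that $A\subseteq T(B_Z)$ for some Banach space $Z$ and some $T\in\mathcal U(Z,F)$, and let $\mathcal H_{\mathcal U}(E,F)$ be the set of all $f\in\mathcal H(E,F)$ such that each $x\in E$ has a neighbourhood $V_x$ with $f(V_x)\in\mathcal C_{\mathcal U}(F)$. **Theorem.** Let $E$, $F$ be complex Banach spaces and let $f:E\to F$ be a mapping. (1) Let $\mathcal U$ be a closed, surjective and factorizable operator ideal. Then $f\in\mathcal H_{\mathcal U}(E,F)$ if and only if there are a complex Banach space $G$ with $I_G\in\mathcal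 U$, a mapping $g\in\mathcal H(E,G)$ and an operator $T\in\mathcal U(G,F)$ such that $f=T\circ g$. (2) Let $\mathcal W$ be the ideal of weakly compact operators. Then $f\in\mathcal H_{\mathcal W}(E,F)$ if and only if there are a reflexive complex Banach space $G$, a mapping $g\in\mathcal H(E,G)$ and an operator $T\in\mathcal W(G,F)$ such that $f=T\circ g$. -/

import Mathlib

open Topology

universe u

/-- An operator ideal on the class of complex Banach spaces: a class of bounded linear operators
containing every rank-one operator `x ↦ φ x • y` (equivalently, the identity of the scalar field),
whose components are closed under addition, and which is stable under composition with arbitrary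
bounded operators on either side. -/
structure OperatorIdeal where
  /-- The component `𝓤(E, F)`. -/
  comp : ∀ (E F : Type u) [NormedAddCommGroup E] [NormedSpace ℂ E] [CompleteSpace E]
    [NormedAddCommGroup F] [NormedSpace ℂ F] [CompleteSpace F], Set (E →L[ℂ] F)
  rankOne_mem : ∀ {E F : Type u} [NormedAddCommGroup E] [NormedSpace ℂ E] [CompleteSpace E]
    [NormedAddCommGroup F] [NormedSpace ℂ F] [CompleteSpace F] (φ : E →L[ℂ] ℂ) (y : F),
    φ.smulRight y ∈ comp E F
  add_mem : ∀ {E F : Type u} [NormedAddCommGroup E] [NormedSpace ℂ E] [CompleteSpace E]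
    [NormedAddCommGroup F] [NormedSpace ℂ F] [CompleteSpace F] {S T : E →L[ℂ] F},
    S ∈ comp E F → T ∈ comp E F → S + T ∈ comp E F
  comp_mem : ∀ {D E F G : Type u} [NormedAddCommGroup D] [NormedSpace ℂ D] [CompleteSpace D]
    [NormedAddCommGroup E] [NormedSpace ℂ E] [CompleteSpace E]
    [NormedAddCommGroup F] [NormedSpace ℂ F] [CompleteSpace F]
    [NormedAddCommGroup G] [NormedSpace ℂ G] [CompleteSpace G]
    (R : F →L[ℂ] G) {S : E →L[ℂ] F} (T : D →L[ℂ] E),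
    S ∈ comp E F → (R.comp S).comp T ∈ comp D G

namespace OperatorIdeal

/-- The ideal is closed: each component is closed in the operator norm. -/
def IsClosedIdeal (U : OperatorIdeal.{u}) : Prop :=
  ∀ (E F : Type u) [NormedAddCommGroup E] [NormedSpace ℂ E] [CompleteSpace E]
    [NormedAddCommGroup F] [NormedSpace ℂ F] [CompleteSpace F], IsClosed (U.comp E F)

/-- The ideal is surjective: if `q` is a surjective operator and `T q ∈ 𝓤`, then `T ∈ 𝓤`. -/
def IsSurjectiveIdeal (U : OperatorIdeal.{u}) : Prop :=
  ∀ (E F G : Type u) [NormedAddCommGroup E] [NormedSpace ℂ E] [CompleteSpace E]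
    [NormedAddCommGroup F] [NormedSpace ℂ F] [CompleteSpace F]
    [NormedAddCommGroup G] [NormedSpace ℂ G] [CompleteSpace G]
    (T : E →L[ℂ] F) (q : G →L[ℂ] E),
    Function.Surjective q → T.comp q ∈ U.comp G F → T ∈ U.comp E F

/-- The ideal is factorizable: every `T ∈ 𝓤(E, F)` factors as `T = j k` through a Banach space
whose identity operator belongs to `𝓤`. -/
def IsFactorizableIdeal (U : OperatorIdeal.{u}) : Prop :=
  ∀ (E F : Type u) [NormedAddCommGroup E] [NormedSpace ℂ E] [CompleteSpace E]
    [NormedAddCommGroup F] [NormedSpace ℂ F] [CompleteSpace F], ∀ T ∈ U.comp E F,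
    ∃ (Y : Type u) (_ : NormedAddCommGroup Y) (_ : NormedSpace ℂ Y) (_ : CompleteSpace Y)
      (k : E →L[ℂ] Y) (j : Y →L[ℂ] F),
      T = j.comp k ∧ ContinuousLinearMap.id ℂ Y ∈ U.comp Y Y

/-- The collection `𝓒_𝓤(F)` of all `A ⊆ F` contained in `T(B_Z)` for some Banach space `Z`, with
closed unit ball `B_Z`, and some `T ∈ 𝓤(Z, F)`. -/
def boundedSets (U : OperatorIdeal.{u}) (F : Type u)
    [NormedAddCommGroup F] [NormedSpace ℂ F] [CompleteSpace F] : Set (Set F) :=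
  {A | ∃ (Z : Type u) (_ : NormedAddCommGroup Z) (_ : NormedSpace ℂ Z) (_ : CompleteSpace Z),
    ∃ T ∈ U.comp Z F, A ⊆ T '' Metric.closedBall (0 : Z) 1}

end OperatorIdeal

/-- The set `𝓗(E, F)` of holomorphic mappings `f : E → F`: those given near every point of `E` by
a convergent series of continuous homogeneous polynomials. -/
def holomorphicMaps (E F : Type u) [NormedAddCommGroup E] [NormedSpace ℂ E]
    [NormedAddCommGroup F] [NormedSpace ℂ F] : Set (E → F) :=
  {f | AnalyticOnNhd ℂ f Set.univ}

/-- The set `𝓗_𝓤(E, F)` of holomorphic `f : E → F` such that every `x ∈ E` has a neighbourhood `V`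
with `f(V) ∈ 𝓒_𝓤(F)`. -/
def OperatorIdeal.holomorphicMaps (U : OperatorIdeal.{u}) (E F : Type u)
    [NormedAddCommGroup E] [NormedSpace ℂ E]
    [NormedAddCommGroup F] [NormedSpace ℂ F] [CompleteSpace F] : Set (E → F) :=
  {f | f ∈ _root_.holomorphicMaps E F ∧ ∀ x : E, ∃ V ∈ 𝓝 x, f '' V ∈ U.boundedSets F}

/-- A subset of a normed space is relatively weakly compact if its closure in the weak topology is
weakly compact. -/
def IsRelWeaklyCompact {F : Type u} [NormedAddCommGroup F] [NormedSpace ℂ F] (A : Set F) : Prop :=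
  IsCompact (closure (toWeakSpace ℂ F '' A))

/-- `T` is weakly compact: the image of the closed unit ball is relatively weakly compact. -/
def IsWeaklyCompactOperator {E F : Type u} [NormedAddCommGroup E] [NormedSpace ℂ E]
    [NormedAddCommGroup F] [NormedSpace ℂ F] (T : E →L[ℂ] F) : Prop :=
  IsRelWeaklyCompact (T '' Metric.closedBall (0 : E) 1)

/-- A normed space is reflexive if the canonical embedding into its bidual is onto. -/
def IsReflexiveSpace (G : Type u) [NormedAddCommGroup G] [NormedSpace ℂ G] : Prop :=
  Function.Surjective (NormedSpace.inclusionInDoubleDual ℂ G)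

instance weakSpace_t2Space (F : Type u) [NormedAddCommGroup F] [NormedSpace ℂ F] :
    T2Space (WeakSpace ℂ F) := by
  refine (WeakBilin.isEmbedding (B := (topDualPairing ℂ F).flip) ?_).t2Space
  intro x y h
  refine (SeparatingDual.eq_iff_forall_dual_eq (R := ℂ)).2 fun φ => ?_
  exact congrArg (fun g => g φ) h

lemma IsRelWeaklyCompact.mono_compact {F : Type u} [NormedAddCommGroup F] [NormedSpace ℂ F]
    {A : Set F} {K : Set (WeakSpace ℂ F)} (hK : IsCompact K)
    (h : toWeakSpace ℂ F '' A ⊆ K) : IsRelWeaklyCompact A :=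
  hK.of_isClosed_subset isClosed_closure (closure_minimal h hK.isClosed)

lemma IsWeaklyCompactOperator.rankOne {E F : Type u} [NormedAddCommGroup E] [NormedSpace ℂ E]
    [NormedAddCommGroup F] [NormedSpace ℂ F] (φ : E →L[ℂ] ℂ) (y : F) :
    IsWeaklyCompactOperator (φ.smulRight y) := by
  have hc : Continuous fun c : ℂ => toWeakSpace ℂ F (c • y) :=
    (toWeakSpaceCLM ℂ F).continuous.comp (continuous_id.smul continuous_const)
  refine IsRelWeaklyCompact.mono_compact
    ((isCompact_closedBall (0 : ℂ) ‖φ‖).image hc) ?_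
  rintro _ ⟨_, ⟨x, hx, rfl⟩, rfl⟩
  refine ⟨φ x, ?_, rfl⟩
  rw [mem_closedBall_zero_iff] at hx ⊢
  exact (φ.le_opNorm x).trans (mul_le_of_le_one_right (norm_nonneg _) hx)

lemma IsWeaklyCompactOperator.add {E F : Type u} [NormedAddCommGroup E] [NormedSpace ℂ E]
    [NormedAddCommGroup F] [NormedSpace ℂ F] {S T : E →L[ℂ] F}
    (hS : IsWeaklyCompactOperator S) (hT : IsWeaklyCompactOperator T) :
    IsWeaklyCompactOperator (S + T) := by
  refine IsRelWeaklyCompact.mono_compact (IsCompact.image (IsCompact.prod hS hT) continuous_add) ?_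
  rintro _ ⟨_, ⟨x, hx, rfl⟩, rfl⟩
  exact ⟨(toWeakSpace ℂ F (S x), toWeakSpace ℂ F (T x)),
    ⟨subset_closure ⟨_, ⟨x, hx, rfl⟩, rfl⟩, subset_closure ⟨_, ⟨x, hx, rfl⟩, rfl⟩⟩, rfl⟩

lemma IsWeaklyCompactOperator.comp_comp {D E F G : Type u}
    [NormedAddCommGroup D] [NormedSpace ℂ D] [NormedAddCommGroup E] [NormedSpace ℂ E]
    [NormedAddCommGroup F] [NormedSpace ℂ F] [NormedAddCommGroup G] [NormedSpace ℂ G]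
    (R : F →L[ℂ] G) {S : E →L[ℂ] F} (T : D →L[ℂ] E) (hS : IsWeaklyCompactOperator S) :
    IsWeaklyCompactOperator ((R.comp S).comp T) := by
  set c : ℂ := ((‖T‖ + 1 : ℝ) : ℂ) with hc
  have hpos : 0 < ‖T‖ + 1 := by positivity
  have hc0 : c ≠ 0 := by rw [hc]; exact_mod_cast hpos.ne'
  have hcn : ‖c‖ = ‖T‖ + 1 := by rw [hc, Complex.norm_real, Real.norm_of_nonneg hpos.le]
  refine IsRelWeaklyCompact.mono_compact
    (IsCompact.image hS (WeakSpace.map (c • R)).continuous) ?_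
  rintro _ ⟨_, ⟨x, hx, rfl⟩, rfl⟩
  refine ⟨toWeakSpace ℂ F (S (c⁻¹ • T x)), subset_closure ⟨_, ⟨c⁻¹ • T x, ?_, rfl⟩, rfl⟩, ?_⟩
  · rw [mem_closedBall_zero_iff] at hx ⊢
    rw [norm_smul, norm_inv, hcn, inv_mul_le_iff₀ hpos, mul_one]
    have := (T.le_opNorm x).trans (mul_le_of_le_one_right (norm_nonneg _) hx)
    linarith
  · change (c • R) (S (c⁻¹ • T x)) = R (S (T x))
    simp [hc0]

/-- The operator ideal of weakly compact operators. -/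
def weaklyCompactIdeal : OperatorIdeal.{u} where
  comp E F _ _ _ _ _ _ := {T : E →L[ℂ] F | IsWeaklyCompactOperator T}
  rankOne_mem φ y := IsWeaklyCompactOperator.rankOne φ y
  add_mem hS hT := IsWeaklyCompactOperator.add hS hT
  comp_mem R _ T hS := IsWeaklyCompactOperator.comp_comp R T hS

/-! ### The space `ℓ¹(I)` -/

section EllOne

variable {I F : Type*} [NormedAddCommGroup F] [NormedSpace ℂ F]

lemma ellOne_summable_norm (x : lp (fun _ : I => ℂ) 1) : Summable fun i => ‖x i‖ := by
  simpa using x.2.summable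

lemma ellOne_norm_eq (x : lp (fun _ : I => ℂ) 1) : ‖x‖ = ∑' i, ‖x i‖ := by
  rw [lp.norm_eq_tsum_rpow (by simp)]
  simp

lemma ellOne_summable_smul [CompleteSpace F] {v : I → F} {C : ℝ} (hv : ∀ i, ‖v i‖ ≤ C)
    (x : lp (fun _ : I => ℂ) 1) : Summable fun i => x i • v i := by
  refine Summable.of_norm_bounded ((ellOne_summable_norm x).mul_right C) fun i => ?_
  rw [norm_smul]
  exact mul_le_mul_of_nonneg_left (hv i) (norm_nonneg _)

/-- A bounded family `v` in a Banach space extends to an operator on `ℓ¹`. -/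
lemma exists_ellOne_lift [CompleteSpace F] [DecidableEq I] {v : I → F} {C : ℝ}
    (hv : ∀ i, ‖v i‖ ≤ C) (hC : 0 ≤ C) :
    ∃ S : lp (fun _ : I => ℂ) 1 →L[ℂ] F,
      (∀ i, S (lp.single 1 i (1 : ℂ)) = v i) ∧ ‖S‖ ≤ C := by
  refine ⟨LinearMap.mkContinuous
    { toFun := fun x => ∑' i, x i • v i
      map_add' := fun x y => ?_
      map_smul' := fun c x => ?_ } C fun x => ?_, fun i => ?_, ?_⟩
  · rw [← (ellOne_summable_smul hv x).tsum_add (ellOne_summable_smul hv y)]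
    simp [add_smul]
  · rw [RingHom.id_apply, ← (ellOne_summable_smul hv x).tsum_const_smul]
    simp [mul_smul]
  · rw [LinearMap.coe_mk, AddHom.coe_mk, ellOne_norm_eq, ← tsum_mul_left]
    refine tsum_of_norm_bounded ((ellOne_summable_norm x).mul_left C).hasSum fun i => ?_
    rw [norm_smul, mul_comm]
    exact mul_le_mul_of_nonneg_right (hv i) (norm_nonneg _)
  · rw [LinearMap.mkContinuous_apply, LinearMap.coe_mk, AddHom.coe_mk, tsum_eq_single i]
    · simp
    · intro j hj
      simp [hj]
  · exact LinearMap.mkContinuous_norm_le _ hC _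

lemma ellOne_ext [DecidableEq I] {S T : lp (fun _ : I => ℂ) 1 →L[ℂ] F}
    (h : ∀ i, S (lp.single 1 i (1 : ℂ)) = T (lp.single 1 i (1 : ℂ))) : S = T := by
  refine lp.ext_continuousLinearMap ENNReal.one_ne_top fun i => ?_
  ext
  simpa using h i

/-- By uniqueness, `S` is the lift of its own values on the unit vectors and inherits the bound of
that lift. -/
lemma ellOne_opNorm_le [CompleteSpace F] [DecidableEq I] {S : lp (fun _ : I => ℂ) 1 →L[ℂ] F}
    {C : ℝ} (hC : 0 ≤ C) (h : ∀ i, ‖S (lp.single 1 i (1 : ℂ))‖ ≤ C) : ‖S‖ ≤ C := by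
  obtain ⟨T, hT, hTC⟩ := exists_ellOne_lift h hC
  rwa [← ellOne_ext hT]

end EllOne

/-! ### The sets bounded with respect to an operator ideal -/

namespace OperatorIdeal

variable {U : OperatorIdeal.{u}}

section

variable {D E F : Type u} [NormedAddCommGroup D] [NormedSpace ℂ D] [CompleteSpace D]
  [NormedAddCommGroup E] [NormedSpace ℂ E] [CompleteSpace E]
  [NormedAddCommGroup F] [NormedSpace ℂ F] [CompleteSpace F]

lemma comp_left_mem (R : E →L[ℂ] F) {S : D →L[ℂ] E} (hS : S ∈ U.comp D E) :
    R.comp S ∈ U.comp D F := by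
  simpa using U.comp_mem R (ContinuousLinearMap.id ℂ D) hS

lemma comp_right_mem {S : E →L[ℂ] F} (hS : S ∈ U.comp E F) (T : D →L[ℂ] E) :
    S.comp T ∈ U.comp D F := by
  simpa using U.comp_mem (ContinuousLinearMap.id ℂ F) T hS

lemma smul_mem (c : ℂ) {S : E →L[ℂ] F} (hS : S ∈ U.comp E F) : c • S ∈ U.comp E F := by
  convert comp_left_mem (c • ContinuousLinearMap.id ℂ F) hS using 1
  ext; simp

end

variable {F : Type u} [NormedAddCommGroup F] [NormedSpace ℂ F] [CompleteSpace F]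

lemma boundedSets_mono {A B : Set F} (hB : B ∈ U.boundedSets F) (h : A ⊆ B) :
    A ∈ U.boundedSets F := by
  obtain ⟨Z, i₁, i₂, i₃, T, hT, hBT⟩ := hB
  exact ⟨Z, i₁, i₂, i₃, T, hT, h.trans hBT⟩

lemma smul_mem_boundedSets (c : ℂ) {A : Set F} (hA : A ∈ U.boundedSets F) :
    (fun a => c • a) '' A ∈ U.boundedSets F := by
  obtain ⟨Z, i₁, i₂, i₃, T, hT, hAT⟩ := hA
  refine ⟨Z, i₁, i₂, i₃, c • T, smul_mem c hT, ?_⟩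
  rintro _ ⟨a, ha, rfl⟩
  obtain ⟨z, hz, rfl⟩ := hAT ha
  exact ⟨z, hz, rfl⟩

lemma exists_norm_le_of_mem_boundedSets {A : Set F} (hA : A ∈ U.boundedSets F) :
    ∃ M, 0 < M ∧ ∀ a ∈ A, ‖a‖ ≤ M := by
  obtain ⟨Z, _, _, _, T, hT, hAT⟩ := hA
  refine ⟨‖T‖ + 1, by positivity, fun a ha => ?_⟩
  obtain ⟨z, hz, rfl⟩ := hAT ha
  rw [mem_closedBall_zero_iff] at hz
  have := (T.le_opNorm z).trans (mul_le_of_le_one_right (norm_nonneg _) hz)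
  linarith

/-- The unit ball of `Z × Y` in the maximum norm is the product of the unit balls, so `(z, y) ↦ T z
+ S y` maps it onto `T(B_Z) + S(B_Y)`. -/
lemma add_mem_boundedSets {A B : Set F} (hA : A ∈ U.boundedSets F) (hB : B ∈ U.boundedSets F) :
    ∃ C ∈ U.boundedSets F, A ⊆ C ∧ B ⊆ C ∧ ∀ a ∈ A, ∀ b ∈ B, a + b ∈ C := by
  obtain ⟨Z, _, _, _, T, hT, hAT⟩ := hA
  obtain ⟨Y, _, _, _, S, hS, hBS⟩ := hB
  refine ⟨(T.comp (ContinuousLinearMap.fst ℂ Z Y) + S.comp (ContinuousLinearMap.snd ℂ Z Y)) ''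
    Metric.closedBall 0 1, ⟨Z × Y, inferInstance, inferInstance, inferInstance, _,
      U.add_mem (comp_right_mem hT _) (comp_right_mem hS _), subset_rfl⟩, ?_, ?_, ?_⟩
  · intro a ha
    obtain ⟨z, hz, rfl⟩ := hAT ha
    exact ⟨(z, 0), by simpa [Prod.norm_def] using hz, by simp⟩
  · intro a ha
    obtain ⟨z, hz, rfl⟩ := hBS ha
    exact ⟨(0, z), by simpa [Prod.norm_def] using hz, by simp⟩
  · intro a ha b hb
    obtain ⟨z, hz, rfl⟩ := hAT ha
    obtain ⟨y, hy, rfl⟩ := hBS hb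
    exact ⟨(z, y), by simpa [Prod.norm_def] using And.intro (mem_closedBall_zero_iff.1 hz) (mem_closedBall_zero_iff.1 hy), by simp⟩

lemma singleton_zero_mem_boundedSets : ({0} : Set F) ∈ U.boundedSets F := by
  refine ⟨F, inferInstance, inferInstance, inferInstance, _,
    U.rankOne_mem (0 : F →L[ℂ] ℂ) (0 : F), ?_⟩
  rintro _ rfl
  exact ⟨0, by simp, by simp⟩

/-- In a closed ideal, a set approximable by bounded sets is bounded. -/
lemma mem_boundedSets_of_approx (hU : U.IsClosedIdeal) {A : Set F}
    (h : ∀ ε : ℝ, 0 < ε → ∃ D ∈ U.boundedSets F, ∀ a ∈ A, ∃ d ∈ D, ‖a - d‖ ≤ ε) :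
    A ∈ U.boundedSets F := by
  classical
  obtain ⟨M, hM, hAM⟩ : ∃ M : ℝ, 0 ≤ M ∧ ∀ a ∈ A, ‖a‖ ≤ M := by
    obtain ⟨D, hD, hAD⟩ := h 1 one_pos
    obtain ⟨M, hM, hDM⟩ := exists_norm_le_of_mem_boundedSets hD
    refine ⟨M + 1, by positivity, fun a ha => ?_⟩
    obtain ⟨d, hd, had⟩ := hAD a ha
    calc ‖a‖ = ‖d + (a - d)‖ := by simp
      _ ≤ ‖d‖ + ‖a - d‖ := norm_add_le _ _
      _ ≤ M + 1 := add_le_add (hDM d hd) had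
  -- The unit vectors of `ℓ¹(A)` go to the points of `A`, so only `S ∈ 𝓤` is at issue.
  obtain ⟨S, hS, -⟩ := exists_ellOne_lift (I := A) (v := fun a => (a : F)) (C := M)
    (fun a => hAM a a.2) hM
  refine ⟨lp (fun _ : A => ℂ) 1, inferInstance, inferInstance, inferInstance, S, ?_, ?_⟩
  · refine (hU _ _).closure_subset (Metric.mem_closure_iff.2 fun ε hε => ?_)
    obtain ⟨D, ⟨Z, _, _, _, R, hR, hDR⟩, hAD⟩ := h (ε / 2) (half_pos hε)
    choose! d hd had using hAD
    have : ∀ a : A, ∃ z : Z, ‖z‖ ≤ 1 ∧ R z = d a := fun a => by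
      obtain ⟨z, hz, hzd⟩ := hDR (hd a a.2)
      exact ⟨z, by simpa using hz, hzd⟩
    choose z hz hzd using this
    -- `R ∘ Q` sends the unit vector at `a` to `d a`. On `ℓ¹`, closeness on unit vectors is
    -- closeness in operator norm.
    obtain ⟨Q, hQ, -⟩ := exists_ellOne_lift hz zero_le_one
    refine ⟨R.comp Q, comp_right_mem hR Q, ?_⟩
    rw [dist_eq_norm]
    refine (ellOne_opNorm_le (half_pos hε).le fun a => ?_).trans_lt (half_lt_self hε)
    simpa [hS, hQ, hzd] using had a a.2
  · intro a ha
    exact ⟨lp.single 1 ⟨a, ha⟩ 1, by simp, hS ⟨a, ha⟩⟩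

/-- A bounded set lies in a bounded set which is moreover closed and absolutely convex. -/
lemma exists_closed_absConvex (hU : U.IsClosedIdeal) {A : Set F} (hA : A ∈ U.boundedSets F) :
    ∃ B ∈ U.boundedSets F, A ⊆ B ∧ IsClosed B ∧ Convex ℝ B ∧
      ∀ c : ℂ, ‖c‖ ≤ 1 → ∀ b ∈ B, c • b ∈ B := by
  obtain ⟨Z, _, _, _, T, hT, hAT⟩ := hA
  have hmem : T '' Metric.closedBall (0 : Z) 1 ∈ U.boundedSets F :=
    ⟨Z, inferInstance, inferInstance, inferInstance, T, hT, subset_rfl⟩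
  -- The set `T(B_Z)` itself approximates its closure, for every `ε`.
  refine ⟨closure (T '' Metric.closedBall 0 1), mem_boundedSets_of_approx hU fun ε hε =>
    ⟨_, hmem, fun a ha => ?_⟩, hAT.trans subset_closure, isClosed_closure, ?_, ?_⟩
  · obtain ⟨d, hd, had⟩ := Metric.mem_closure_iff.1 ha ε hε
    exact ⟨d, hd, by rw [← dist_eq_norm]; exact had.le⟩
  · exact ((convex_closedBall (0 : Z) 1).linear_image (T.toLinearMap.restrictScalars ℝ)).closure
  · intro c hc b hb
    refine map_mem_closure (continuous_const_smul c) hb ?_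
    rintro _ ⟨z, hz, rfl⟩
    rw [mem_closedBall_zero_iff] at hz
    refine ⟨c • z, ?_, by simp⟩
    rw [mem_closedBall_zero_iff, norm_smul]
    exact mul_le_one₀ hc (norm_nonneg _) hz

/-- The point `0` is kept in `C` to approximate the small sets of the tail in `exists_absorbing`. -/
lemma finite_union_mem_boundedSets (A : ℕ → Set F) (hA : ∀ n, A n ∈ U.boundedSets F) (N : ℕ) :
    ∃ C ∈ U.boundedSets F, (0 : F) ∈ C ∧ ∀ n < N, A n ⊆ C := by
  induction N with
  | zero => exact ⟨{0}, singleton_zero_mem_boundedSets, rfl, fun n hn => by omega⟩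
  | succ N ih =>
    obtain ⟨C, hC, h0, hAC⟩ := ih
    obtain ⟨D, hD, h1, h2, -⟩ := add_mem_boundedSets hC (hA N)
    refine ⟨D, hD, h1 h0, fun n hn => ?_⟩
    rcases Nat.lt_succ_iff_lt_or_eq.1 hn with h | rfl
    · exact (hAC n h).trans h1
    · exact h2

lemma finite_sum_mem_boundedSets {X : Type*} (s : Set X) (P : ℕ → X → F)
    (hP : ∀ n, P n '' s ∈ U.boundedSets F) (N : ℕ) :
    (fun x => ∑ n ∈ Finset.range N, P n x) '' s ∈ U.boundedSets F := by
  induction N with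
  | zero =>
    refine boundedSets_mono singleton_zero_mem_boundedSets ?_
    rintro _ ⟨x, -, rfl⟩
    simp
  | succ N ih =>
    obtain ⟨D, hD, -, -, h⟩ := add_mem_boundedSets ih (hP N)
    refine boundedSets_mono hD ?_
    rintro _ ⟨x, hx, rfl⟩
    simp only [Finset.sum_range_succ]
    exact h _ ⟨x, hx, rfl⟩ _ ⟨x, hx, rfl⟩

/-- In a closed ideal, countably many bounded sets are absorbed by a single one. -/
lemma exists_absorbing (hU : U.IsClosedIdeal) (A : ℕ → Set F) (hA : ∀ n, A n ∈ U.boundedSets F) :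
    ∃ B ∈ U.boundedSets F, ∀ n, ∃ c : ℝ, 0 < c ∧ ∀ a ∈ A n, (c : ℂ) • a ∈ B := by
  choose M hM hAM using fun n => exists_norm_le_of_mem_boundedSets (hA n)
  -- With these factors the scaled sets shrink to `0`, so up to `ε` only finitely many matter.
  let c : ℕ → ℝ := fun n => (1 / 2) ^ n / M n
  have hc : ∀ n, 0 < c n := fun n => div_pos (by positivity) (hM n)
  have hcn : ∀ n, ∀ a ∈ A n, ‖(c n : ℂ) • a‖ ≤ (1 / 2) ^ n := fun n a ha => by
    rw [norm_smul, Complex.norm_real, Real.norm_of_nonneg (hc n).le]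
    calc c n * ‖a‖ ≤ c n * M n := mul_le_mul_of_nonneg_left (hAM n a ha) (hc n).le
      _ = (1 / 2) ^ n := div_mul_cancel₀ _ (hM n).ne'
  refine ⟨⋃ n, (fun a => (c n : ℂ) • a) '' A n, mem_boundedSets_of_approx hU fun ε hε => ?_,
    fun n => ⟨c n, hc n, fun a ha => Set.mem_iUnion.2 ⟨n, a, ha, rfl⟩⟩⟩
  obtain ⟨N, hN⟩ := exists_pow_lt_of_lt_one hε (one_half_lt_one (α := ℝ))
  obtain ⟨C, hC, h0, hCA⟩ := finite_union_mem_boundedSets _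
    (fun n => smul_mem_boundedSets (c n : ℂ) (hA n)) N
  refine ⟨C, hC, fun b hb => ?_⟩
  obtain ⟨n, a, ha, rfl⟩ := Set.mem_iUnion.1 hb
  rcases lt_or_ge n N with h | h
  · exact ⟨_, hCA n h ⟨a, ha, rfl⟩, by simpa using hε.le⟩
  · refine ⟨0, h0, ?_⟩
    rw [sub_zero]
    exact ((hcn n a ha).trans (pow_le_pow_of_le_one (by norm_num) (by norm_num) h)).trans hN.le

/-- In a surjective ideal, a bounded set lies in the image of the unit ball under an injective
operator of the ideal. -/
lemma exists_injective (hU : U.IsSurjectiveIdeal) {A : Set F} (hA : A ∈ U.boundedSets F) :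
    ∃ (G : Type u) (_ : NormedAddCommGroup G) (_ : NormedSpace ℂ G) (_ : CompleteSpace G),
      ∃ J ∈ U.comp G F, Function.Injective J ∧ A ⊆ J '' Metric.closedBall (0 : G) 1 := by
  obtain ⟨Z, _, _, _, T, hT, hAT⟩ := hA
  have hK : IsClosed (T.ker : Set Z) := T.isClosed_ker
  let q : Z →L[ℂ] Z ⧸ T.ker := T.ker.mkQL
  let J : (Z ⧸ T.ker) →L[ℂ] F := T.ker.liftQL T le_rfl
  have hJq : J.comp q = T := by ext; rfl
  have hq : Function.Surjective q := Submodule.mkQ_surjective _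
  refine ⟨Z ⧸ T.ker, inferInstance, inferInstance, inferInstance, J,
    hU _ _ _ J q hq (by rwa [hJq]), ?_, ?_⟩
  · refine (injective_iff_map_eq_zero J).2 fun x hx => ?_
    obtain ⟨z, rfl⟩ := hq x
    exact (Submodule.Quotient.mk_eq_zero _).2 hx
  · intro a ha
    obtain ⟨z, hz, rfl⟩ := hAT ha
    refine ⟨q z, ?_, rfl⟩
    rw [mem_closedBall_zero_iff] at hz ⊢
    exact (Submodule.Quotient.norm_mk_le _ z).trans hz

end OperatorIdeal

/-! ### Cauchy estimates relative to closed absolutely convex sets -/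

section Cauchy

variable {E F G : Type*} [NormedAddCommGroup E] [NormedSpace ℂ E]
  [NormedAddCommGroup F] [NormedSpace ℂ F] [NormedAddCommGroup G] [NormedSpace ℂ G]

/-- A function with values in a closed absolutely convex set `A` on a closed ball of radius `s`
has, at the centre, directional derivatives in `s⁻¹ A`. -/
lemma smul_fderiv_mem {f : E → F} (hf : Differentiable ℂ f) {A : Set F} (hA : IsClosed A)
    (hconv : Convex ℝ A) (hbal : ∀ c : ℂ, ‖c‖ ≤ 1 → ∀ a ∈ A, c • a ∈ A) {s : ℝ} (hs : 0 < s)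
    {z : E} (hz : ∀ w ∈ Metric.closedBall z s, f w ∈ A) {v : E} (hv : ‖v‖ ≤ 1) :
    (s : ℂ) • fderiv ℂ f z v ∈ A := by
  by_contra hnot
  -- A separating functional reduces the claim to the scalar Cauchy estimate on a complex line;
  -- balancedness turns the bound on `Re φ` into one on `‖φ‖`.
  obtain ⟨φ, t, hφ, ht⟩ := RCLike.geometric_hahn_banach_closed_point (𝕜 := ℂ) hconv hA hnot
  have hnorm : ∀ a ∈ A, ‖φ a‖ ≤ t := fun a ha => by
    obtain ⟨c, hc, hca⟩ : ∃ c : ℂ, ‖c‖ = 1 ∧ c * φ a = ‖φ a‖ := RCLike.exists_norm_eq_mul_self _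
      |>.imp fun c h => ⟨h.1, h.2.symm⟩
    have := hφ _ (hbal c hc.le a ha)
    rw [map_smul, smul_eq_mul, hca] at this
    simpa using this.le
  have hline : Differentiable ℂ fun l : ℂ => φ (f (z + l • v)) := by fun_prop
  have hderiv : deriv (fun l : ℂ => φ (f (z + l • v))) 0 = φ (fderiv ℂ f z v) := by
    have h1 : HasDerivAt (fun l : ℂ => z + l • v) v 0 := by
      simpa using ((hasDerivAt_id (0 : ℂ)).smul_const v).const_add z
    have h2 : HasFDerivAt f (fderiv ℂ f z) (z + (0 : ℂ) • v) := by
      simpa using (hf z).hasFDerivAt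
    exact (φ.hasFDerivAt.comp_hasDerivAt 0 (h2.comp_hasDerivAt 0 h1)).deriv
  have hle := Complex.norm_deriv_le_of_forall_mem_sphere_norm_le (c := 0) (C := t) hs
    hline.diffContOnCl fun l hl => hnorm _ <| hz _ ?_
  · rw [hderiv, le_div_iff₀ hs] at hle
    have h3 : RCLike.re (φ ((s : ℂ) • fderiv ℂ f z v)) ≤ ‖φ ((s : ℂ) • fderiv ℂ f z v)‖ :=
      RCLike.re_le_norm _
    rw [map_smul, norm_smul, Complex.norm_real, Real.norm_of_nonneg hs.le] at h3
    rw [map_smul] at ht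
    linarith
  · rw [mem_closedBall_iff_norm, add_sub_cancel_left, norm_smul]
    rw [mem_sphere_zero_iff_norm] at hl
    rw [hl]
    exact mul_le_of_le_one_right hs.le hv

/-- Cauchy's estimate for all the derivatives, relative to a closed absolutely convex set. -/
lemma smul_iteratedFDeriv_mem {f : E → F} (hf : ContDiff ℂ ⊤ f) {A : Set F} (hA : IsClosed A)
    (hconv : Convex ℝ A) (hbal : ∀ c : ℂ, ‖c‖ ≤ 1 → ∀ a ∈ A, c • a ∈ A) {s : ℝ} (hs : 0 < s)
    (k : ℕ) {z : E} (hz : ∀ w ∈ Metric.closedBall z (k * s), f w ∈ A)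
    {v : Fin k → E} (hv : ∀ i, ‖v i‖ ≤ 1) :
    (s : ℂ) ^ k • iteratedFDeriv ℂ k f z v ∈ A := by
  induction k generalizing z with
  | zero => simpa using hz z (by simp)
  | succ k ih =>
    have hd : Differentiable ℂ (iteratedFDeriv ℂ k f) :=
      hf.differentiable_iteratedFDeriv (WithTop.coe_lt_top _)
    let h : E → F := fun w => (s : ℂ) ^ k • iteratedFDeriv ℂ k f w (Fin.tail v)
    have hh : ∀ w, HasFDerivAt h ((s : ℂ) ^ k •
        (ContinuousMultilinearMap.apply ℂ (fun _ : Fin k => E) F (Fin.tail v)).comp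
          (fderiv ℂ (iteratedFDeriv ℂ k f) w)) w := fun w =>
      ((ContinuousMultilinearMap.apply ℂ (fun _ : Fin k => E) F
        (Fin.tail v)).hasFDerivAt.comp w (hd w).hasFDerivAt).const_smul _
    -- Each differentiation costs radius `s`: by induction `h` has values in `A` on the ball of
    -- radius `s`, as the radius `(k + 1) s` leaves `k s` around each of its points.
    have hmem := smul_fderiv_mem (f := h) (fun w => (hh w).differentiableAt) hA hconv hbal hs
      (z := z) (v := v 0) (fun w hw => ih (fun y hy => hz y ?_) fun i => hv i.succ) (hv 0)
    · rw [(hh z).fderiv] at hmem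
      rw [iteratedFDeriv_succ_apply_left, pow_succ', mul_smul]
      exact hmem
    · rw [Metric.mem_closedBall] at hw hy ⊢
      push_cast
      linarith [dist_triangle y w z]

/-- Restriction to complex lines makes the one-variable Taylor and Cauchy theorems available. -/
lemma iteratedDeriv_comp_line {f : E → F} (hf : ContDiff ℂ ⊤ f) (x y : E) (k : ℕ) :
    iteratedDeriv k (fun l : ℂ => f (x + l • y)) 0 = iteratedFDeriv ℂ k f x fun _ => y := by
  let L : ℂ →L[ℂ] E := ContinuousLinearMap.toSpanSingleton ℂ y
  have hfx : ContDiff ℂ ⊤ fun w => f (x + w) := hf.comp (contDiff_const.add contDiff_id)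
  change iteratedDeriv k ((fun w => f (x + w)) ∘ L) 0 = _
  rw [iteratedDeriv_eq_iteratedFDeriv, L.iteratedFDeriv_comp_right hfx 0 le_top,
    iteratedFDeriv_comp_add_left]
  simp [L]

lemma differentiable_comp_line {f : E → F} (hf : ContDiff ℂ ⊤ f) (x y : E) :
    Differentiable ℂ fun l : ℂ => f (x + l • y) :=
  (hf.differentiable (by simp)).comp (by fun_prop)

/-- The Taylor series of an entire function converges to it everywhere. -/
lemma hasSum_iteratedFDeriv [CompleteSpace F] {f : E → F} (hf : ContDiff ℂ ⊤ f) (x y : E) :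
    HasSum (fun k : ℕ => ((k.factorial : ℂ)⁻¹) • iteratedFDeriv ℂ k f x fun _ => y)
      (f (x + y)) := by
  have := Complex.hasSum_taylorSeries_of_entire (differentiable_comp_line hf x y) 0 1
  simpa [iteratedDeriv_comp_line hf] using this

/-- A function `g` is analytic if `J ∘ g` is entire for some injective operator `J` and `J ∘ g` has
locally values in a closed absolutely convex set contained in the image of a ball. -/
lemma analyticAt_of_comp [CompleteSpace F] [CompleteSpace G] {J : G →L[ℂ] F}
    (hJ : Function.Injective J) {g : E → G} (hf : ContDiff ℂ ⊤ (J ∘ g)) {A : Set F}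
    (hA : IsClosed A) (hconv : Convex ℝ A) (hbal : ∀ c : ℂ, ‖c‖ ≤ 1 → ∀ a ∈ A, c • a ∈ A)
    {C : ℝ} (hAJ : A ⊆ J '' Metric.closedBall 0 C) {x : E} {R : ℝ} (hR : 0 < R)
    (hx : ∀ w ∈ Metric.closedBall x R, J (g w) ∈ A) : AnalyticAt ℂ g x := by
  set f : E → F := J ∘ g with hfdef
  -- values of the derivatives
  have key : ∀ (k : ℕ) (v : Fin k → E),
      ∃ u : G, J u = iteratedFDeriv ℂ k f x v ∧ ‖u‖ ≤ C * (k / R) ^ k * ∏ i, ‖v i‖ := by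
    intro k v
    -- The radius per derivative will be `R / k`, which is not positive for `k = 0`.
    rcases Nat.eq_zero_or_pos k with rfl | hk
    · refine ⟨g x, by simp [hfdef], ?_⟩
      obtain ⟨u, hu, hux⟩ := hAJ (hx x (by simp [hR.le]))
      simpa [hJ hux] using hu
    have hk' : (0 : ℝ) < k := by exact_mod_cast hk
    have hs : 0 < R / k := div_pos hR hk'
    -- Where `v i = 0` the inverse is `0` by convention, and `w i = 0` still has norm at most one.
    let w : Fin k → E := fun i => (‖v i‖ : ℂ)⁻¹ • v i
    have hw : ∀ i, ‖w i‖ ≤ 1 := fun i => by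
      simp only [w, norm_smul, norm_inv, Complex.norm_real, norm_norm]
      exact inv_mul_le_one
    have hvw : v = fun i => (‖v i‖ : ℂ) • w i := by
      funext i
      rcases eq_or_ne (v i) 0 with h | h
      · simp [h]
      · have : (‖v i‖ : ℂ) ≠ 0 := by exact_mod_cast norm_ne_zero_iff.2 h
        simp [w, smul_smul, this]
    have hmem := smul_iteratedFDeriv_mem hf hA hconv hbal hs k (z := x) (v := w)
      (by rwa [mul_div_cancel₀ _ hk'.ne']) hw
    obtain ⟨u, hu, hux⟩ := hAJ hmem
    rw [mem_closedBall_zero_iff] at hu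
    have hs' : ((R / k : ℝ) : ℂ) ≠ 0 := by exact_mod_cast hs.ne'
    refine ⟨(∏ i, (‖v i‖ : ℂ)) • (((R / k : ℝ) : ℂ) ^ k)⁻¹ • u, ?_, ?_⟩
    · rw [map_smul, map_smul, hux, inv_smul_smul₀ (pow_ne_zero _ hs')]
      conv_rhs => rw [hvw, ContinuousMultilinearMap.map_smul_univ]
    · rw [norm_smul, norm_smul, norm_prod, norm_inv, norm_pow, Complex.norm_real,
        Real.norm_of_nonneg hs.le, ← inv_pow, inv_div]
      simp only [Complex.norm_real, norm_norm]
      rw [mul_comm]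
      refine mul_le_mul_of_nonneg_right ?_ (Finset.prod_nonneg fun i _ => norm_nonneg _)
      rw [mul_comm]
      exact mul_le_mul_of_nonneg_right hu (by positivity)
  choose q hqJ hq using key
  have hC : 0 ≤ C := by simpa using (norm_nonneg _).trans (hq 0 fun i => i.elim0)
  -- Multilinearity of `q k` holds after applying `J`, hence before, `J` being injective.
  let q' : FormalMultilinearSeries ℂ E G := fun k => MultilinearMap.mkContinuous
    { toFun := q k
      map_update_add' := fun v i a b => hJ (by simp [hqJ])
      map_update_smul' := fun v i c a => hJ (by simp [hqJ]) } (C * (k / R) ^ k) (hq k)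
  let p : FormalMultilinearSeries ℂ E G := fun k => ((k.factorial : ℂ)⁻¹) • q' k
  have hpJ : ∀ k v, J (p k v) = ((k.factorial : ℂ)⁻¹) • iteratedFDeriv ℂ k f x v := fun k v => by
    rw [← hqJ, ← map_smul]
    rfl
  have hpn : ∀ k, ‖p k‖ ≤ C * (Real.exp 1 / R) ^ k := fun k => by
    have h1 : ‖p k‖ ≤ (k.factorial : ℝ)⁻¹ * (C * (k / R) ^ k) := by
      refine (norm_smul_le ((k.factorial : ℂ)⁻¹) (q' k)).trans ?_
      rw [norm_inv, Complex.norm_natCast]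
      exact mul_le_mul_of_nonneg_left (MultilinearMap.mkContinuous_norm_le _ (by positivity) _)
        (by positivity)
    -- This absorbs the loss from splitting the radius into `k` parts; the radius of convergence is
    -- at least `R / e`.
    have h2 : (k : ℝ) ^ k / k.factorial ≤ Real.exp 1 ^ k := by
      rw [← Real.exp_nat_mul, mul_one]
      exact Real.pow_div_factorial_le_exp _ (Nat.cast_nonneg k) k
    calc ‖p k‖ ≤ (k.factorial : ℝ)⁻¹ * (C * (k / R) ^ k) := h1
      _ = C * ((k : ℝ) ^ k / k.factorial * (R⁻¹) ^ k) := by rw [div_eq_mul_inv (k : ℝ), mul_pow]; ring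
      _ ≤ C * (Real.exp 1 ^ k * (R⁻¹) ^ k) := by gcongr
      _ = C * (Real.exp 1 / R) ^ k := by rw [← mul_pow, div_eq_mul_inv]
  let r : NNReal := ⟨R / Real.exp 1, by positivity⟩
  have hr : 0 < r := by
    rw [← NNReal.coe_pos]
    exact div_pos hR (Real.exp_pos 1)
  have hrad : (r : ENNReal) ≤ p.radius := by
    refine p.le_radius_of_bound C fun k => ?_
    calc ‖p k‖ * (r : ℝ) ^ k ≤ C * (Real.exp 1 / R) ^ k * (R / Real.exp 1) ^ k :=
          mul_le_mul_of_nonneg_right (hpn k) (by positivity)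
      _ = C := by
          rw [mul_assoc, ← mul_pow, div_mul_div_cancel₀ hR.ne', div_self (Real.exp_pos 1).ne',
            one_pow, mul_one]
  refine ⟨p, r, hrad, by exact_mod_cast hr, fun {y} hy => ?_⟩
  have hsum := p.hasSum (Metric.eball_subset_eball hrad hy)
  have h1 := hsum.map J J.continuous
  have h2 := hasSum_iteratedFDeriv hf x y
  have h3 : J (p.sum y) = f (x + y) := h1.unique (by simpa [Function.comp_def, hpJ] using h2)
  rwa [hJ h3] at hsum

end Cauchy

/-! ### Factorization through an injective operator of the ideal -/

/-- The `k`-th homogeneous Taylor polynomial at the origin. -/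
noncomputable def taylorPolynomial {E F : Type*} [NormedAddCommGroup E] [NormedSpace ℂ E]
    [NormedAddCommGroup F] [NormedSpace ℂ F] (f : E → F) (k : ℕ) (y : E) : F :=
  ((k.factorial : ℂ)⁻¹) • iteratedFDeriv ℂ k f 0 fun _ => y

/-! ### Geometric decay of the Taylor series at the origin -/

section

variable {E F : Type*} [NormedAddCommGroup E] [NormedSpace ℂ E]
  [NormedAddCommGroup F] [NormedSpace ℂ F]

/-- The points of norm at most `m` at which the Taylor polynomials at the origin decay
geometrically with constant `m`. -/
def geometricDecaySet (f : E → F) (m : ℕ) : Set E :=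
  {y | ‖y‖ ≤ m ∧ ∀ k, ‖taylorPolynomial f k y‖ ≤ m * (1 / 2) ^ k}

/-- By compactness of the circle `|l| = 2`, `f (l • y)` is bounded uniformly for `y` near `x`.
Cauchy's estimate on that circle gives the ratio `1 / 2`. -/
lemma exists_closedBall_subset_geometricDecaySet [CompleteSpace F] {f : E → F}
    (hf : ContDiff ℂ ⊤ f) (x : E) :
    ∃ m : ℕ, ∃ R : ℝ, 0 < R ∧ Metric.closedBall x R ⊆ geometricDecaySet f m := by
  have hcont : Continuous fun q : E × ℂ => f (q.2 • q.1) := by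
    have := hf.continuous
    fun_prop
  obtain ⟨M, hM⟩ := (((isCompact_sphere (0 : ℂ) 2).image
    (hcont.comp (Continuous.prodMk_right x))).isBounded).exists_norm_le
  have hev : ∀ᶠ y in 𝓝 x, ∀ l ∈ Metric.sphere (0 : ℂ) 2, ‖f (l • y)‖ < M + 1 := by
    refine (isCompact_sphere (0 : ℂ) 2).eventually_forall_of_forall_eventually fun l hl => ?_
    have h1 : ‖f (l • x)‖ < M + 1 := (hM _ ⟨l, hl, rfl⟩).trans_lt (lt_add_one M)
    exact (hcont.norm.continuousAt (x := (x, l))).eventually (gt_mem_nhds h1)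
  obtain ⟨R, hR, hball⟩ := Metric.nhds_basis_closedBall.eventually_iff.1 hev
  obtain ⟨m, hm⟩ := exists_nat_ge (max (M + 1) (‖x‖ + R))
  refine ⟨m, R, hR, fun y hy => ⟨?_, fun k => ?_⟩⟩
  · rw [mem_closedBall_iff_norm] at hy
    have : ‖y‖ ≤ ‖x‖ + ‖y - x‖ := norm_le_norm_add_norm_sub' y x
    linarith [le_max_right (M + 1) (‖x‖ + R)]
  · have hle := Complex.norm_iteratedDeriv_le_of_forall_mem_sphere_norm_le k (c := 0)
      (two_pos : (0 : ℝ) < 2) (differentiable_comp_line hf 0 y).diffContOnCl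
      (fun l hl => by simpa using (hball hy l hl).le)
    rw [iteratedDeriv_comp_line hf] at hle
    rw [taylorPolynomial, norm_smul, norm_inv, Complex.norm_natCast]
    have hfac : (0 : ℝ) < k.factorial := by exact_mod_cast k.factorial_pos
    rw [inv_mul_le_iff₀ hfac]
    refine hle.trans ?_
    rw [one_div, inv_pow, div_eq_mul_inv, mul_assoc]
    gcongr
    exact (le_max_left _ _).trans hm

lemma norm_sub_taylor_le [CompleteSpace F] {f : E → F} (hf : ContDiff ℂ ⊤ f) {m : ℕ} {y : E}
    (hy : y ∈ geometricDecaySet f m) (N : ℕ) :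
    ‖f y - ∑ k ∈ Finset.range N, taylorPolynomial f k y‖ ≤ m * (1 / 2) ^ N * 2 := by
  have hsum : HasSum (fun k => taylorPolynomial f k y) (f y) := by
    simpa [taylorPolynomial] using hasSum_iteratedFDeriv hf 0 y
  rw [← ((hasSum_nat_add_iff' N).2 hsum).tsum_eq]
  have hg : HasSum (fun k : ℕ => (m : ℝ) * (1 / 2) ^ N * (1 / 2) ^ k) (m * (1 / 2) ^ N * 2) :=
    hasSum_geometric_two.mul_left _
  refine tsum_of_norm_bounded hg fun k => (hy.2 (k + N)).trans_eq ?_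
  rw [pow_add]
  ring

end

namespace OperatorIdeal

variable {U : OperatorIdeal.{u}} {E F : Type u} [NormedAddCommGroup E] [NormedSpace ℂ E]
  [NormedAddCommGroup F] [NormedSpace ℂ F] [CompleteSpace F]

lemma contDiff_of_mem_holomorphicMaps {f : E → F} (hf : f ∈ U.holomorphicMaps E F) :
    ContDiff ℂ ⊤ f :=
  contDiff_iff_contDiffAt.2 fun x => (hf.1 x (Set.mem_univ x)).contDiffAt

/-- Only the neighbourhood of the origin is used: the Cauchy estimate there, extended by homogeneity
to all bounded sets. -/
lemma image_taylorPolynomial_mem (hU : U.IsClosedIdeal) {f : E → F}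
    (hf : f ∈ U.holomorphicMaps E F) (m k : ℕ) :
    taylorPolynomial f k '' {y | ‖y‖ ≤ m} ∈ U.boundedSets F := by
  obtain ⟨V, hV, hVU⟩ := hf.2 0
  obtain ⟨r, hr, hrV⟩ := Metric.nhds_basis_closedBall.mem_iff.1 hV
  obtain ⟨A, hA, hVA, hcl, hconv, hbal⟩ := exists_closed_absConvex hU hVU
  have hs : 0 < r / (k + 1) := by positivity
  -- The `+ 1` keeps `s` defined at `k = 0` while `k * s ≤ r`; likewise `m + 1` below covers `m =
  -- 0`.
  set s : ℝ := r / (k + 1) with hsdef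
  have hs0 : (s : ℂ) ≠ 0 := by exact_mod_cast hs.ne'
  refine boundedSets_mono (smul_mem_boundedSets
    ((k.factorial : ℂ)⁻¹ * ((s : ℂ) ^ k)⁻¹ * ((m : ℂ) + 1) ^ k) hA) ?_
  rintro _ ⟨y, hy, rfl⟩
  have hm0 : (m : ℂ) + 1 ≠ 0 := by exact_mod_cast m.succ_ne_zero
  have hmn : ‖(m : ℂ) + 1‖ = m + 1 := by exact_mod_cast Complex.norm_natCast (m + 1)
  refine ⟨_, smul_iteratedFDeriv_mem (contDiff_of_mem_holomorphicMaps hf) hcl hconv hbal hs k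
    (z := 0) (v := fun _ => ((m : ℂ) + 1)⁻¹ • y) (fun w hw => hVA ⟨w, hrV ?_, rfl⟩) fun _ => ?_, ?_⟩
  · refine Metric.closedBall_subset_closedBall ?_ hw
    rw [hsdef, mul_div_assoc', div_le_iff₀ (by positivity)]
    nlinarith
  · rw [norm_smul, norm_inv, hmn, inv_mul_le_iff₀ (by positivity)]
    have : ‖y‖ ≤ m := hy
    linarith
  · have h1 := (iteratedFDeriv ℂ k f 0).map_smul_univ (fun _ => ((m : ℂ) + 1)⁻¹) fun _ => y
    simp only [Finset.prod_const, Finset.card_univ, Fintype.card_fin] at h1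
    simp only [h1, smul_smul, taylorPolynomial]
    congr 1
    rw [inv_pow]
    field_simp

lemma image_geometricDecaySet_mem (hU : U.IsClosedIdeal) {f : E → F}
    (hf : f ∈ U.holomorphicMaps E F) (m : ℕ) :
    f '' geometricDecaySet f m ∈ U.boundedSets F := by
  refine mem_boundedSets_of_approx hU fun ε hε => ?_
  obtain ⟨N, hN⟩ := exists_pow_lt_of_lt_one (show 0 < ε / (2 * (m + 1)) by positivity)
    (one_half_lt_one (α := ℝ))
  refine ⟨_, finite_sum_mem_boundedSets _ _ (image_taylorPolynomial_mem hU hf m) N, ?_⟩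
  rintro _ ⟨y, hy, rfl⟩
  refine ⟨_, ⟨y, hy.1, rfl⟩,
    (norm_sub_taylor_le (contDiff_of_mem_holomorphicMaps hf) hy N).trans ?_⟩
  rw [lt_div_iff₀ (by positivity)] at hN
  nlinarith [show (0 : ℝ) < (1 / 2) ^ N by positivity]

/-- For a closed surjective ideal, the mappings in `𝓗_𝓤` factor through an injective operator of
the ideal. -/
lemma exists_factorization (hcl : U.IsClosedIdeal) (hsurj : U.IsSurjectiveIdeal) {f : E → F}
    (hf : f ∈ U.holomorphicMaps E F) :
    ∃ (G : Type u) (_ : NormedAddCommGroup G) (_ : NormedSpace ℂ G) (_ : CompleteSpace G),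
      ∃ g ∈ _root_.holomorphicMaps E G, ∃ J ∈ U.comp G F, f = J ∘ g := by
  obtain ⟨B, hB, hBc⟩ := exists_absorbing hcl _ (image_geometricDecaySet_mem hcl hf)
  obtain ⟨A, hA, hBA, hAcl, hconv, hbal⟩ := exists_closed_absConvex hcl hB
  obtain ⟨G, _, _, _, J, hJ, hinj, hAJ⟩ := exists_injective hsurj hA
  have hcov : ∀ x, ∃ R : ℝ, 0 < R ∧ ∃ c : ℝ, 0 < c ∧ ∀ w ∈ Metric.closedBall x R,
      (c : ℂ) • f w ∈ A := fun x => by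
    obtain ⟨m, R, hR, hsub⟩ :=
      exists_closedBall_subset_geometricDecaySet (contDiff_of_mem_holomorphicMaps hf) x
    obtain ⟨c, hc, hcB⟩ := hBc m
    exact ⟨R, hR, c, hc, fun w hw => hBA (hcB _ ⟨w, hsub hw, rfl⟩)⟩
  have hex : ∀ x, ∃ y, J y = f x := fun x => by
    obtain ⟨R, hR, c, hc, hw⟩ := hcov x
    obtain ⟨y, -, hy⟩ := hAJ (hw x (by simp [hR.le]))
    have hc0 : (c : ℂ) ≠ 0 := by exact_mod_cast hc.ne'
    exact ⟨(c : ℂ)⁻¹ • y, by rw [map_smul, hy, inv_smul_smul₀ hc0]⟩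
  choose g hg using hex
  refine ⟨G, inferInstance, inferInstance, inferInstance, g, fun x _ => ?_, J, hJ,
    funext fun x => (hg x).symm⟩
  obtain ⟨R, hR, c, hc, hw⟩ := hcov x
  have hc0 : (c : ℂ) ≠ 0 := by exact_mod_cast hc.ne'
  have hfg : J ∘ (fun x => (c : ℂ) • g x) = fun x => (c : ℂ) • f x := by
    ext x
    simp [hg]
  -- Near `x` only the multiple `c • f` has values in `A`, so analyticity is proved for `c • g`.
  have han := analyticAt_of_comp hinj (g := fun x => (c : ℂ) • g x)
    (hfg ▸ (contDiff_of_mem_holomorphicMaps hf).const_smul (c : ℂ)) hAcl hconv hbal hAJ hR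
    (fun w hwR => by simpa [hg] using hw w hwR)
  have := han.const_smul (c := (c : ℂ)⁻¹)
  exact this.congr (Filter.Eventually.of_forall fun y => inv_smul_smul₀ hc0 (g y))

/-- A composition of a holomorphic mapping with an operator of the ideal lies in `𝓗_𝓤`. -/
lemma comp_mem_holomorphicMaps {G : Type u} [NormedAddCommGroup G] [NormedSpace ℂ G]
    [CompleteSpace G] {g : E → G} (hg : g ∈ _root_.holomorphicMaps E G) {T : G →L[ℂ] F}
    (hT : T ∈ U.comp G F) : T ∘ g ∈ U.holomorphicMaps E F := by
  refine ⟨fun x hx => (T.analyticAt _).comp (hg x hx), fun x => ?_⟩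
  refine ⟨g ⁻¹' Metric.closedBall (g x) 1,
    (hg x (Set.mem_univ x)).continuousAt.preimage_mem_nhds
      (Metric.closedBall_mem_nhds _ one_pos), ?_⟩
  have hc : (0 : ℝ) < ‖g x‖ + 1 := by positivity
  set c : ℂ := ((‖g x‖ + 1 : ℝ) : ℂ) with hcdef
  have hcn : ‖c‖ = ‖g x‖ + 1 := by rw [hcdef, Complex.norm_real, Real.norm_of_nonneg hc.le]
  have hc0 : c ≠ 0 := by rw [hcdef]; exact_mod_cast hc.ne'
  refine boundedSets_mono (smul_mem_boundedSets c
    ⟨G, inferInstance, inferInstance, inferInstance, T, hT, subset_rfl⟩) ?_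
  rintro _ ⟨w, hw, rfl⟩
  refine ⟨_, ⟨c⁻¹ • g w, ?_, rfl⟩, by simp [hc0]⟩
  rw [Set.mem_preimage, mem_closedBall_iff_norm] at hw
  rw [mem_closedBall_zero_iff, norm_smul, norm_inv, hcn, inv_mul_le_iff₀ hc]
  have : ‖g w‖ ≤ ‖g x‖ + ‖g w - g x‖ := norm_le_norm_add_norm_sub' _ _
  linarith

end OperatorIdeal

/-! ### Weak compactness through ultrafilters -/

section WeakCompactness

variable {E F : Type u} [NormedAddCommGroup E] [NormedSpace ℂ E]
  [NormedAddCommGroup F] [NormedSpace ℂ F]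

/-- Every ultrafilter on `A` converges weakly. -/
def UltrafilterWeaklyCompact (A : Set F) : Prop :=
  ∀ l : Ultrafilter F, A ∈ l → ∃ y : F, ∀ φ : StrongDual ℂ F, Filter.Tendsto φ l (𝓝 (φ y))

lemma IsRelWeaklyCompact.ultrafilter {A : Set F} (hA : IsRelWeaklyCompact A) :
    UltrafilterWeaklyCompact A := by
  intro l hl
  obtain ⟨y, -, hy⟩ := isCompact_iff_ultrafilter_le_nhds'.1 hA (l.map (toWeakSpace ℂ F))
    (Filter.mem_of_superset (Filter.image_mem_map hl) subset_closure)
  refine ⟨(toWeakSpace ℂ F).symm y, fun φ => ?_⟩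
  have hφ : Continuous fun z : WeakSpace ℂ F => φ ((toWeakSpace ℂ F).symm z) :=
    WeakBilin.eval_continuous (topDualPairing ℂ F).flip φ
  exact (hφ.tendsto y).comp hy

/-- It suffices that the weak* closure of `A` in the bidual stays in `F`. A point of it is the limit
of an ultrafilter on `A`, hence equals that ultrafilter's weak limit in `F`. -/
lemma UltrafilterWeaklyCompact.isRelWeaklyCompact {A : Set F} (hA : UltrafilterWeaklyCompact A)
    (hb : Bornology.IsBounded A) : IsRelWeaklyCompact A := by
  refine NormedSpace.isCompact_closure_of_isBounded ℂ F _ ?_ ?_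
  · rwa [Set.preimage_image_eq _ (toWeakSpace ℂ F).injective]
  · intro ξ hξ
    obtain ⟨l, hl, hlξ⟩ := mem_closure_iff_ultrafilter.1 hξ
    let m : F → WeakDual ℂ (StrongDual ℂ F) :=
      fun x => NormedSpace.inclusionInDoubleDualWeak ℂ F (toWeakSpace ℂ F x)
    have hm : Function.Injective m :=
      (NormedSpace.isEmbedding_inclusionInDoubleDualWeak ℂ F).injective.comp
        (toWeakSpace ℂ F).injective
    have hrange : Set.range m ∈ l := by
      refine Filter.mem_of_superset hl ?_
      rintro _ ⟨_, ⟨x, -, rfl⟩, rfl⟩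
      exact ⟨x, rfl⟩
    obtain ⟨y, hy⟩ := hA (l.comap hm hrange) <| by
      rw [Set.image_image] at hl
      exact (Ultrafilter.mem_comap l hm hrange).2 hl
    refine ⟨toWeakSpace ℂ F y, ?_⟩
    refine ContinuousLinearMap.ext fun φ => ?_
    have h1 : Filter.Tendsto (fun ζ : WeakDual ℂ (StrongDual ℂ F) => ζ φ) l (𝓝 (ξ φ)) :=
      ((WeakDual.eval_continuous φ).tendsto ξ).mono_left hlξ
    have h2 : Filter.Tendsto (fun x => m x φ) (l.comap hm hrange) (𝓝 (ξ φ)) := by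
      refine h1.comp ?_
      rw [Ultrafilter.coe_comap]
      exact Filter.tendsto_comap
    exact tendsto_nhds_unique (hy φ) h2

lemma UltrafilterWeaklyCompact.mono {A B : Set F} (hB : UltrafilterWeaklyCompact B)
    (h : A ⊆ B) : UltrafilterWeaklyCompact A :=
  fun l hl => hB l (Filter.mem_of_superset hl h)

/-- A set approximable in norm by relatively weakly compact sets is relatively weakly compact. -/
lemma UltrafilterWeaklyCompact.of_approx [CompleteSpace F] {A : Set F}
    (h : ∀ ε : ℝ, 0 < ε → ∃ D, UltrafilterWeaklyCompact D ∧ ∀ a ∈ A, ∃ d ∈ D, ‖a - d‖ ≤ ε) :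
    UltrafilterWeaklyCompact A := by
  intro l hl
  have hpos : ∀ n : ℕ, (0 : ℝ) < 1 / (n + 1) := fun n => Nat.one_div_pos_of_nat
  choose D hD hAD using fun n : ℕ => h _ (hpos n)
  choose! d hdD hd using hAD
  have hlim : ∀ n, ∃ y : F, ∀ φ : StrongDual ℂ F,
      Filter.Tendsto (fun a => φ (d n a)) l (𝓝 (φ y)) := fun n => by
    obtain ⟨y, hy⟩ := hD n (l.map (d n)) (Ultrafilter.mem_map.2
      (Filter.mem_of_superset hl fun a ha => hdD n a ha))
    exact ⟨y, fun φ => hy φ⟩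
  choose y hy using hlim
  -- The norm is weakly lower semicontinuous, so the weak limits of the approximants form a Cauchy
  -- sequence; its limit is the weak limit of `l`.
  have hyy : ∀ n m, ‖y n - y m‖ ≤ 1 / (n + 1) + 1 / (m + 1) := fun n m => by
    refine NormedSpace.norm_le_dual_bound ℂ _ (by positivity) fun φ => ?_
    rw [map_sub]
    refine le_of_tendsto ((hy n φ).sub (hy m φ)).norm (Filter.mem_of_superset hl fun a ha => ?_)
    rw [Set.mem_ofPred_eq, ← map_sub, mul_comm]
    refine (φ.le_opNorm _).trans (mul_le_mul_of_nonneg_left ?_ (norm_nonneg _))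
    calc ‖d n a - d m a‖ = ‖(a - d m a) - (a - d n a)‖ := by rw [sub_sub_sub_cancel_left]
      _ ≤ ‖a - d m a‖ + ‖a - d n a‖ := norm_sub_le _ _
      _ ≤ 1 / (m + 1) + 1 / (n + 1) := add_le_add (hd m a ha) (hd n a ha)
      _ = _ := add_comm _ _
  have hcauchy : CauchySeq y := by
    have h0 := (tendsto_one_div_add_atTop_nhds_zero_nat (𝕜 := ℝ)).add
      (tendsto_one_div_add_atTop_nhds_zero_nat (𝕜 := ℝ))
    rw [add_zero] at h0
    refine cauchySeq_of_le_tendsto_0 _ (fun n m N hn hm => ?_) h0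
    rw [dist_eq_norm]
    exact (hyy n m).trans (add_le_add (Nat.one_div_le_one_div hn) (Nat.one_div_le_one_div hm))
  obtain ⟨z, hz⟩ := cauchySeq_tendsto_of_complete hcauchy
  refine ⟨z, fun φ => Metric.tendsto_nhds.2 fun ε hε => ?_⟩
  have h1 : ∀ᶠ n : ℕ in Filter.atTop, ‖φ‖ * (1 / ((n : ℝ) + 1)) < ε / 3 := by
    have : Filter.Tendsto (fun n : ℕ => ‖φ‖ * (1 / ((n : ℝ) + 1))) Filter.atTop (𝓝 0) := by
      simpa using (tendsto_one_div_add_atTop_nhds_zero_nat (𝕜 := ℝ)).const_mul ‖φ‖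
    exact this.eventually (gt_mem_nhds (by positivity))
  have h2 : ∀ᶠ n in Filter.atTop, dist (φ (y n)) (φ z) < ε / 3 :=
    Metric.tendsto_nhds.1 ((φ.continuous.tendsto z).comp hz) _ (by positivity)
  obtain ⟨n, hn1, hn2⟩ := (h1.and h2).exists
  filter_upwards [hl, Metric.tendsto_nhds.1 (hy n φ) (ε / 3) (by positivity)] with a ha h3
  have h4 : dist (φ a) (φ (d n a)) < ε / 3 := by
    rw [dist_eq_norm, ← map_sub]
    exact ((φ.le_opNorm _).trans
      (mul_le_mul_of_nonneg_left (hd n a ha) (norm_nonneg _))).trans_lt hn1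
  linarith [dist_triangle (φ a) (φ (d n a)) (φ z), dist_triangle (φ (d n a)) (φ (y n)) (φ z)]

lemma isBounded_image_closedBall (T : E →L[ℂ] F) (r : ℝ) :
    Bornology.IsBounded (T '' Metric.closedBall 0 r) :=
  T.lipschitz.isBounded_image Metric.isBounded_closedBall

lemma isWeaklyCompactOperator_iff {T : E →L[ℂ] F} :
    IsWeaklyCompactOperator T ↔ UltrafilterWeaklyCompact (T '' Metric.closedBall 0 1) :=
  ⟨fun h => IsRelWeaklyCompact.ultrafilter h,
    fun h => h.isRelWeaklyCompact (isBounded_image_closedBall T 1)⟩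

end WeakCompactness

/-! ### The weakly compact operators form a closed surjective ideal -/

lemma weaklyCompactIdeal_isClosedIdeal : weaklyCompactIdeal.{u}.IsClosedIdeal := by
  intro E F _ _ _ _ _ _
  refine isClosed_of_closure_subset fun T hT => ?_
  refine isWeaklyCompactOperator_iff.2 (UltrafilterWeaklyCompact.of_approx fun ε hε => ?_)
  obtain ⟨S, hS, hST⟩ := Metric.mem_closure_iff.1 hT ε hε
  refine ⟨_, isWeaklyCompactOperator_iff.1 hS, ?_⟩
  rintro _ ⟨x, hx, rfl⟩
  refine ⟨S x, ⟨x, hx, rfl⟩, ?_⟩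
  rw [mem_closedBall_zero_iff] at hx
  rw [dist_eq_norm] at hST
  rw [← sub_apply]
  exact ((T - S).le_opNorm x).trans ((mul_le_of_le_one_right (norm_nonneg _) hx).trans hST.le)

lemma weaklyCompactIdeal_isSurjectiveIdeal : weaklyCompactIdeal.{u}.IsSurjectiveIdeal := by
  intro E F G _ _ _ _ _ _ _ _ _ T q hq hTq
  -- By the open mapping theorem `B_E ⊆ q(C B_G)`, whence `T(B_E) ⊆ C T q(B_G)`.
  obtain ⟨C, hC, hpre⟩ := q.exists_preimage_norm_le hq
  have hsm : IsWeaklyCompactOperator ((C : ℂ) • T.comp q) :=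
    OperatorIdeal.smul_mem (U := weaklyCompactIdeal) (C : ℂ) hTq
  have hC0 : (C : ℂ) ≠ 0 := by exact_mod_cast hC.ne'
  refine isWeaklyCompactOperator_iff.2 ((isWeaklyCompactOperator_iff.1 hsm).mono ?_)
  rintro _ ⟨x, hx, rfl⟩
  rw [mem_closedBall_zero_iff] at hx
  obtain ⟨w, rfl, hw⟩ := hpre x
  refine ⟨(C : ℂ)⁻¹ • w, ?_, ?_⟩
  · rw [mem_closedBall_zero_iff, norm_smul, norm_inv, Complex.norm_real,
      Real.norm_of_nonneg hC.le, inv_mul_le_iff₀ hC]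
    exact hw.trans (mul_le_mul_of_nonneg_left hx hC.le)
  · rw [smul_apply, ← map_smul, smul_inv_smul₀ hC0]
    rfl

/-! ### Reflexivity -/

section Reflexive

/-- A point that no functional separates from a convex set is a weak limit of points of it. -/
lemma exists_ultrafilter_tendsto_of_convex {V W : Type*} [AddCommGroup V] [Module ℂ V]
    [AddCommGroup W] [Module ℂ W] (B : V →ₗ[ℂ] W →ₗ[ℂ] ℂ) {s : Set V} {x : V}
    (hs : ∀ y ∈ s, ∀ z ∈ s, ∀ a b : ℝ, 0 ≤ a → 0 ≤ b → a + b = 1 →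
      (a : ℂ) • y + (b : ℂ) • z ∈ s) (hx : ∀ w t, (∀ a ∈ s, (B a w).re < t) → (B x w).re ≤ t) :
    ∃ l : Ultrafilter V, s ∈ l ∧ ∀ w, Filter.Tendsto (fun v => B v w) l (𝓝 (B x w)) := by
  let s' : Set (WeakBilin B) := s
  let x' : WeakBilin B := x
  have hs' : Convex ℝ s' := fun y hy z hz a b ha hb hab => hs y hy z hz a b ha hb hab
  have hcl : x' ∈ closure s' := by
    by_contra hnot
    have : ContinuousSMul ℝ (WeakBilin B) := IsScalarTower.continuousSMul ℂ
    obtain ⟨f, t, hf, ht⟩ :=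
      RCLike.geometric_hahn_banach_closed_point (𝕜 := ℂ) hs'.closure isClosed_closure hnot
    obtain ⟨w, rfl⟩ := LinearMap.dualEmbedding_surjective _ f
    exact (hx w t fun a ha => hf a (subset_closure ha)).not_gt ht
  obtain ⟨l, hl, hlx⟩ := mem_closure_iff_ultrafilter.1 hcl
  exact ⟨l, hl, fun w => ((WeakBilin.eval_continuous B w).tendsto x').mono_left hlx⟩

/-- Goldstine's theorem: a functional of norm at most one on the dual is a weak limit of points of
the closed unit ball. -/
lemma exists_ultrafilter_tendsto_bidual {Y : Type u} [NormedAddCommGroup Y] [NormedSpace ℂ Y]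
    {ξ : StrongDual ℂ (StrongDual ℂ Y)} (hξ : ‖ξ‖ ≤ 1) :
    ∃ l : Ultrafilter Y, Metric.closedBall (0 : Y) 1 ∈ l ∧
      ∀ φ : StrongDual ℂ Y, Filter.Tendsto φ l (𝓝 (ξ φ)) := by
  let m : Y →ₗ[ℂ] StrongDual ℂ (StrongDual ℂ Y) :=
    (NormedSpace.inclusionInDoubleDual ℂ Y).toLinearMap
  obtain ⟨v, hv, hvξ⟩ := exists_ultrafilter_tendsto_of_convex
    (ContinuousLinearMap.coeLM ℂ : StrongDual ℂ (StrongDual ℂ Y) →ₗ[ℂ] StrongDual ℂ Y →ₗ[ℂ] ℂ)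
    (s := m '' Metric.closedBall 0 1) (x := ξ)
    (by
      rintro _ ⟨y, hy, rfl⟩ _ ⟨z, hz, rfl⟩ a b ha hb hab
      exact ⟨(a : ℂ) • y + (b : ℂ) • z, convex_closedBall (0 : Y) 1 hy hz ha hb hab,
        by rw [map_add, map_smul, map_smul]⟩)
    fun φ t hf => by
      have hre : ∀ x : Y, ‖x‖ ≤ 1 → (φ x).re < t := fun x hx => hf _ ⟨x, by simpa using hx, rfl⟩
      have ht0 : 0 < t := by simpa using hre 0 (by simp)
      have hφ : ‖φ‖ ≤ t := by
        refine ContinuousLinearMap.opNorm_le_of_unit_norm ht0.le fun x hx => ?_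
        obtain ⟨c, hc, hcx⟩ := RCLike.exists_norm_eq_mul_self (φ x)
        have := hre (c • x) (by rw [norm_smul, hc, hx, one_mul])
        rw [map_smul, smul_eq_mul, ← hcx] at this
        simpa using this.le
      exact (Complex.re_le_norm _).trans (((ξ.le_opNorm φ).trans
        (mul_le_of_le_one_left (norm_nonneg _) hξ)).trans hφ)
  -- The ultrafilter lives on the bidual and contains the image of the ball; it is pulled back to
  -- one on `Y`.
  refine ⟨Ultrafilter.ofComapInfPrincipal hv, Ultrafilter.ofComapInfPrincipal_mem hv, fun φ => ?_⟩
  have hm : Filter.Tendsto m (Ultrafilter.ofComapInfPrincipal hv) v := by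
    rw [Filter.Tendsto, ← Ultrafilter.coe_map, Ultrafilter.ofComapInfPrincipal_eq_of_map hv]
  exact (hvξ φ).comp hm

lemma isReflexiveSpace_of_unit {Y : Type u} [NormedAddCommGroup Y] [NormedSpace ℂ Y]
    (h : ∀ ξ : StrongDual ℂ (StrongDual ℂ Y), ‖ξ‖ ≤ 1 →
      ∃ y : Y, ∀ φ : StrongDual ℂ Y, ξ φ = φ y) : IsReflexiveSpace Y := by
  intro ξ
  have hc : (0 : ℝ) < ‖ξ‖ + 1 := by positivity
  set c : ℂ := ((‖ξ‖ + 1 : ℝ) : ℂ) with hcdef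
  have hcn : ‖c‖ = ‖ξ‖ + 1 := by rw [hcdef, Complex.norm_real, Real.norm_of_nonneg hc.le]
  have hc0 : c ≠ 0 := by rw [hcdef]; exact_mod_cast hc.ne'
  obtain ⟨y, hy⟩ := h (c⁻¹ • ξ) (by
    refine (ContinuousLinearMap.opNorm_smul_le c⁻¹ ξ).trans ?_
    rw [norm_inv, hcn, inv_mul_le_iff₀ hc]
    linarith)
  refine ⟨c • y, ContinuousLinearMap.ext fun φ => ?_⟩
  rw [NormedSpace.dual_def, map_smul, ← hy φ, smul_apply, smul_inv_smul₀ hc0]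

lemma sum_norm_sq_le {X : ℕ → Type*} [∀ n, NormedAddCommGroup (X n)] (s : Finset ℕ)
    (x : lp X 2) : ∑ i ∈ s, ‖x i‖ ^ 2 ≤ ‖x‖ ^ 2 := by
  have h1 := lp.norm_compl_sum_single (p := 2) (by norm_num) x s
  simp only [ENNReal.toReal_ofNat, Real.rpow_ofNat] at h1
  nlinarith [sq_nonneg ‖x - ∑ i ∈ s, lp.single 2 i (x i)‖]

variable {X : ℕ → Type u} [∀ n, NormedAddCommGroup (X n)] [∀ n, NormedSpace ℂ (X n)]

/-- The projection of an `ℓ²`-sum onto its first `N` coordinates. -/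
noncomputable def ellTwoTrunc (X : ℕ → Type u) [∀ n, NormedAddCommGroup (X n)]
    [∀ n, NormedSpace ℂ (X n)] (N : ℕ) : lp X 2 →L[ℂ] lp X 2 :=
  ∑ i ∈ Finset.range N, (lp.singleContinuousLinearMap ℂ X 2 i).comp (lp.evalCLM ℂ X 2 i)

lemma ellTwoTrunc_apply (N : ℕ) (x : lp X 2) :
    ellTwoTrunc X N x = ∑ i ∈ Finset.range N, lp.single 2 i (x i) := by
  rw [ellTwoTrunc, sum_apply]
  rfl

lemma ellTwoTrunc_trunc (N : ℕ) (x : lp X 2) :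
    ellTwoTrunc X N (ellTwoTrunc X N x) = ellTwoTrunc X N x := by
  rw [ellTwoTrunc_apply N (ellTwoTrunc X N x), ellTwoTrunc_apply]
  refine Finset.sum_congr rfl fun i hi => ?_
  congr 1
  rw [lp.coeFn_sum, Finset.sum_apply, Finset.sum_eq_single i]
  · simp
  · intro j _ hj
    simp [hj.symm]
  · exact fun h => (h hi).elim

/-- Pythagoras holds across coordinates although the summands need not be Hilbert spaces. -/
lemma norm_sq_eq_trunc (N : ℕ) (x : lp X 2) :
    ‖x‖ ^ 2 = ‖ellTwoTrunc X N x‖ ^ 2 + ‖x - ellTwoTrunc X N x‖ ^ 2 := by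
  have h1 := lp.norm_compl_sum_single (p := 2) (by norm_num) x (Finset.range N)
  have h2 := lp.norm_sum_single (p := 2) (by norm_num) (fun i => x i) (Finset.range N)
  rw [← ellTwoTrunc_apply] at h1 h2
  simp only [ENNReal.toReal_ofNat, Real.rpow_ofNat] at h1 h2
  linarith

/-- A functional on an `ℓ²`-sum is approximated in norm by its restrictions to finitely many
coordinates. -/
lemma exists_norm_sub_trunc_le (φ : StrongDual ℂ (lp X 2)) {ε : ℝ} (hε : 0 < ε) :
    ∃ N, ∀ x, ‖φ (x - ellTwoTrunc X N x)‖ ≤ ε * ‖x‖ := by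
  set a := ‖φ‖ with ha
  have ha0 : 0 ≤ a := norm_nonneg φ
  set t := ε / (1 + a) with ht
  have ht0 : 0 < t := by positivity
  -- Perturbing a nearly norming, truncated vector by `t` times a tail vector raises the norm by at
  -- most `t² / 2` but the value of `φ` by `t ‖φ (Q w)‖`. So `‖φ (Q w)‖ ≤ t (1 + a) = ε`.
  obtain ⟨x₀, hx₀, hφx₀⟩ := φ.exists_lt_apply_of_lt_opNorm
    (show a - t ^ 2 < ‖φ‖ by rw [← ha]; linarith [sq_pos_of_pos ht0])
  have hlim : Filter.Tendsto (fun N => ‖φ (ellTwoTrunc X N x₀)‖) Filter.atTop (𝓝 ‖φ x₀‖) := by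
    have := (lp.hasSum_single (p := 2) (by norm_num) x₀).tendsto_sum_nat
    simp only [← ellTwoTrunc_apply] at this
    exact ((φ.continuous.tendsto _).comp this).norm
  obtain ⟨N, hN⟩ := (hlim.eventually (lt_mem_nhds hφx₀)).exists
  refine ⟨N, fun x => ?_⟩
  let Q : lp X 2 →L[ℂ] lp X 2 := ContinuousLinearMap.id ℂ _ - ellTwoTrunc X N
  suffices ‖φ.comp Q‖ ≤ ε from (φ.comp Q).le_of_opNorm_le this x
  refine ContinuousLinearMap.opNorm_le_of_unit_norm hε.le fun w hw => ?_
  obtain ⟨c, hc, hcu⟩ := RCLike.exists_norm_eq_mul_self (φ (ellTwoTrunc X N x₀))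
  obtain ⟨d, hd, hdw⟩ := RCLike.exists_norm_eq_mul_self (φ (Q w))
  set u := c • ellTwoTrunc X N x₀ with hu
  set v := ((t : ℂ) * d) • Q w with hv
  have hPu : ellTwoTrunc X N u = u := by rw [hu, map_smul, ellTwoTrunc_trunc]
  have hPv : ellTwoTrunc X N v = 0 := by
    rw [hv, map_smul]
    simp [Q, ellTwoTrunc_trunc]
  have hu1 : ‖u‖ ^ 2 ≤ 1 := by
    rw [hu, norm_smul, hc, one_mul]
    have := norm_sq_eq_trunc N x₀
    nlinarith [sq_nonneg ‖x₀ - ellTwoTrunc X N x₀‖, norm_nonneg x₀]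
  have hv1 : ‖v‖ ^ 2 ≤ t ^ 2 := by
    rw [hv, norm_smul, norm_mul, hd, Complex.norm_real, Real.norm_of_nonneg ht0.le, mul_one,
      mul_pow]
    have := norm_sq_eq_trunc N w
    rw [hw] at this
    have hQ : ‖Q w‖ ^ 2 ≤ 1 := by
      change ‖w - ellTwoTrunc X N w‖ ^ 2 ≤ 1
      nlinarith [sq_nonneg ‖ellTwoTrunc X N w‖]
    nlinarith [sq_nonneg t]
  have hsum : ‖u + v‖ ≤ 1 + t ^ 2 / 2 := by
    have := norm_sq_eq_trunc N (u + v)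
    rw [map_add, hPu, hPv, add_zero, add_sub_cancel_left] at this
    refine abs_le_of_sq_le_sq' ?_ (by positivity) |>.2
    nlinarith [sq_nonneg (t ^ 2)]
  have hφuv : φ (u + v) = ((‖φ (ellTwoTrunc X N x₀)‖ + t * ‖φ (Q w)‖ : ℝ) : ℂ) := by
    have h1 : ((‖φ (ellTwoTrunc X N x₀)‖ : ℝ) : ℂ) = c * φ (ellTwoTrunc X N x₀) := hcu
    have h2 : ((‖φ (Q w)‖ : ℝ) : ℂ) = d * φ (Q w) := hdw
    rw [map_add, hu, hv, map_smul, map_smul, smul_eq_mul, smul_eq_mul]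
    push_cast
    rw [h1, h2]
    ring
  have hle := φ.le_opNorm (u + v)
  rw [hφuv, Complex.norm_real, Real.norm_of_nonneg (by positivity), ← ha] at hle
  have h3 : a * ‖u + v‖ ≤ a * (1 + t ^ 2 / 2) := mul_le_mul_of_nonneg_left hsum ha0
  change ‖φ (Q w)‖ ≤ ε
  have h4 : t * ‖φ (Q w)‖ ≤ t * (t * (1 + a)) := by nlinarith [sq_nonneg t]
  have h5 : t * (1 + a) = ε := div_mul_cancel₀ _ (by positivity)
  rw [h5] at h4
  exact le_of_mul_le_mul_left h4 ht0

variable {F : Type u} [NormedAddCommGroup F] [NormedSpace ℂ F]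

/-- A diagonal subspace `Y` of an `ℓ²`-sum of renormings of `F` is reflexive as soon as its unit
ball is relatively weakly compact in `F`. -/
lemma isReflexiveSpace_of_diagonal (s : ∀ n, X n ≃L[ℂ] F) (Y : Submodule ℂ (lp X 2))
    (hY : ∀ x : lp X 2, x ∈ Y ↔ ∀ n, s n (x n) = s 0 (x 0))
    (hw : UltrafilterWeaklyCompact
      ((fun x : Y => s 0 ((x : lp X 2) 0)) '' Metric.closedBall (0 : Y) 1)) :
    IsReflexiveSpace Y := by
  refine isReflexiveSpace_of_unit fun ξ hξ => ?_
  obtain ⟨l, hl, hlξ⟩ := exists_ultrafilter_tendsto_bidual hξ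
  obtain ⟨y₀, hy₀⟩ := hw (l.map fun x : Y => s 0 ((x : lp X 2) 0))
    (Filter.image_mem_map hl)
  have hball : ∀ᶠ x : Y in l, ‖x‖ ≤ 1 := by
    filter_upwards [hl] with x hx using mem_closedBall_zero_iff.1 hx
  let y : ∀ n, X n := fun n => (s n).symm y₀
  have hlim : ∀ n (ψ : StrongDual ℂ (X n)),
      Filter.Tendsto (fun x : Y => ψ ((x : lp X 2) n)) l (𝓝 (ψ (y n))) := fun n ψ => by
    refine (hy₀ (ψ.comp ((s n).symm : F →L[ℂ] X n))).congr fun x => ?_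
    simp [← (hY x).1 x.2 n]
  -- Norming functionals and `a b ≤ a² / 2 + b² / 2` bound each partial sum of `‖y n‖²` by half of
  -- itself plus `1 / 2`.
  have hmem : Memℓp y 2 := by
    refine memℓp_gen' (C := 1) fun t => ?_
    simp only [ENNReal.toReal_ofNat, Real.rpow_ofNat]
    choose ψ hψ1 hψ using fun n => exists_dual_vector'' ℂ (y n)
    have h1 : Filter.Tendsto
        (fun x : Y => ∑ n ∈ t, ‖y n‖ * RCLike.re (ψ n ((x : lp X 2) n))) l
        (𝓝 (∑ n ∈ t, ‖y n‖ * RCLike.re (ψ n (y n)))) :=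
      tendsto_finsetSum _ fun n _ =>
        ((RCLike.continuous_re.tendsto _).comp (hlim n (ψ n))).const_mul _
    have h2 : ∑ n ∈ t, ‖y n‖ * RCLike.re (ψ n (y n)) = ∑ n ∈ t, ‖y n‖ ^ 2 :=
      Finset.sum_congr rfl fun n _ => by rw [hψ n]; simp [sq]
    rw [h2] at h1
    have h3 : ∑ n ∈ t, ‖y n‖ ^ 2 ≤ (∑ n ∈ t, ‖y n‖ ^ 2) / 2 + 1 / 2 := by
      refine le_of_tendsto h1 (hball.mono fun x hx => ?_)
      have h4 : ∑ n ∈ t, ‖(x : lp X 2) n‖ ^ 2 ≤ 1 :=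
        (sum_norm_sq_le t (x : lp X 2)).trans (pow_le_one₀ (norm_nonneg _) hx)
      calc ∑ n ∈ t, ‖y n‖ * RCLike.re (ψ n ((x : lp X 2) n))
          ≤ ∑ n ∈ t, (‖y n‖ ^ 2 / 2 + ‖(x : lp X 2) n‖ ^ 2 / 2) := by
            refine Finset.sum_le_sum fun n _ => ?_
            have h5 : RCLike.re (ψ n ((x : lp X 2) n)) ≤ ‖(x : lp X 2) n‖ :=
              (RCLike.re_le_norm _).trans (((ψ n).le_opNorm _).trans
                (mul_le_of_le_one_left (norm_nonneg _) (hψ1 n)))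
            nlinarith [norm_nonneg (y n), sq_nonneg (‖y n‖ - ‖(x : lp X 2) n‖),
              mul_le_mul_of_nonneg_left h5 (norm_nonneg (y n))]
        _ ≤ (∑ n ∈ t, ‖y n‖ ^ 2) / 2 + 1 / 2 := by
            rw [Finset.sum_add_distrib, ← Finset.sum_div, ← Finset.sum_div]
            linarith
    linarith
  let z : lp X 2 := ⟨y, hmem⟩
  have hz : z ∈ Y := (hY z).2 fun n => by
    change s n ((s n).symm y₀) = s 0 ((s 0).symm y₀)
    simp
  refine ⟨⟨z, hz⟩, fun φ => ?_⟩
  -- Coordinatewise weak convergence handles finitely many coordinates of `Φ`; the rest is uniformly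
  -- small on the ball.
  obtain ⟨Φ, hΦ, -⟩ := exists_extension_norm_eq Y φ
  rw [← hΦ]
  refine eq_of_forall_dist_le fun ε hε => ?_
  have hpos : 0 < ε / (1 + ‖z‖) := by positivity
  obtain ⟨N, hN⟩ := exists_norm_sub_trunc_le Φ hpos
  have h1 : Filter.Tendsto (fun x : Y => Φ (ellTwoTrunc X N x)) l
      (𝓝 (Φ (ellTwoTrunc X N z))) := by
    simp only [ellTwoTrunc_apply, map_sum]
    exact tendsto_finsetSum _ fun i _ =>
      hlim i (Φ.comp (lp.singleContinuousLinearMap ℂ X 2 i))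
  have h2 : ‖ξ φ - Φ (ellTwoTrunc X N z)‖ ≤ ε / (1 + ‖z‖) := by
    refine le_of_tendsto ((hlξ φ).sub h1).norm (hball.mono fun x hx => ?_)
    rw [← hΦ, ← map_sub]
    exact (hN x).trans (mul_le_of_le_one_right hpos.le hx)
  have h3 := hN z
  rw [map_sub, norm_sub_rev, ← dist_eq_norm] at h3
  rw [← dist_eq_norm] at h2
  calc dist (ξ φ) (Φ z) ≤ ε / (1 + ‖z‖) + ε / (1 + ‖z‖) * ‖z‖ :=
        (dist_triangle _ _ _).trans (add_le_add h2 h3)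
    _ = ε := by field_simp

end Reflexive

/-! ### Factorization of weakly compact operators through reflexive spaces -/

section Factorization

/-- A surjective operator `S` renorms its codomain by the quotient norm. -/
lemma exists_quotient_renorming {Z F : Type u} [NormedAddCommGroup Z] [NormedSpace ℂ Z]
    [CompleteSpace Z] [NormedAddCommGroup F] [NormedSpace ℂ F] [CompleteSpace F]
    (S : Z →L[ℂ] F) (hS : Function.Surjective S) :
    ∃ (X : Type u) (_ : NormedAddCommGroup X) (_ : NormedSpace ℂ X) (_ : CompleteSpace X)
      (s : X ≃L[ℂ] F) (q : Z →L[ℂ] X), (∀ z, s (q z) = S z) ∧ (∀ z, ‖q z‖ ≤ ‖z‖) ∧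
        ∀ x, ‖x‖ ≤ 1 → ∃ z, q z = x ∧ ‖z‖ ≤ 2 := by
  have hK : IsClosed (S.ker : Set Z) := S.isClosed_ker
  let q : Z →L[ℂ] Z ⧸ S.ker := S.ker.mkQL
  let J : (Z ⧸ S.ker) →L[ℂ] F := S.ker.liftQL S le_rfl
  have hq : Function.Surjective q := Submodule.mkQ_surjective _
  have hinj : J.ker = ⊥ := by
    refine LinearMap.ker_eq_bot'.2 fun x hx => ?_
    obtain ⟨z, rfl⟩ := hq x
    exact (Submodule.Quotient.mk_eq_zero _).2 hx
  have hsurj : J.range = ⊤ := LinearMap.range_eq_top.2 fun y => by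
    obtain ⟨z, rfl⟩ := hS y
    exact ⟨q z, rfl⟩
  refine ⟨Z ⧸ S.ker, inferInstance, inferInstance, inferInstance,
    ContinuousLinearEquiv.ofBijective J hinj hsurj, q, fun z => rfl,
    fun z => Submodule.Quotient.norm_mk_le _ z, fun x hx => ?_⟩
  obtain ⟨z, hz, hzx⟩ := Submodule.Quotient.norm_mk_lt x one_pos
  exact ⟨z, hz, by linarith⟩

/-- The operator `(e, y) ↦ 2ⁿ T e + 2⁻ⁿ y`. -/
noncomputable def scaledSum {E F : Type*} [NormedAddCommGroup E] [NormedSpace ℂ E]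
    [NormedAddCommGroup F] [NormedSpace ℂ F] (T : E →L[ℂ] F) (n : ℕ) : E × F →L[ℂ] F :=
  (2 : ℂ) ^ n • T.comp (ContinuousLinearMap.fst ℂ E F) +
    ((2 : ℂ) ^ n)⁻¹ • ContinuousLinearMap.snd ℂ E F

lemma scaledSum_apply {E F : Type*} [NormedAddCommGroup E] [NormedSpace ℂ E]
    [NormedAddCommGroup F] [NormedSpace ℂ F] (T : E →L[ℂ] F) (n : ℕ) (z : E × F) :
    scaledSum T n z = (2 : ℂ) ^ n • T z.1 + ((2 : ℂ) ^ n)⁻¹ • z.2 := rfl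

/-- Operators with summable norms into the summands form an operator into the `ℓ²`-sum. -/
lemma exists_ellTwo_operator {E : Type*} [NormedAddCommGroup E] [NormedSpace ℂ E]
    {X : ℕ → Type u} [∀ n, NormedAddCommGroup (X n)] [∀ n, NormedSpace ℂ (X n)]
    [∀ n, CompleteSpace (X n)] (k : ∀ n, E →L[ℂ] X n) (hk : Summable fun n => ‖k n‖) :
    ∃ K : E →L[ℂ] lp X 2, ∀ e n, K e n = k n e := by
  have hsum : Summable fun n => (lp.singleContinuousLinearMap ℂ X 2 n).comp (k n) := by
    refine Summable.of_norm_bounded hk fun n => ?_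
    refine ContinuousLinearMap.opNorm_le_bound _ (norm_nonneg _) fun e => ?_
    rw [ContinuousLinearMap.comp_apply, lp.singleContinuousLinearMap_apply,
      lp.norm_single (by norm_num)]
    exact (k n).le_opNorm e
  refine ⟨∑' n, (lp.singleContinuousLinearMap ℂ X 2 n).comp (k n), fun e m => ?_⟩
  have h1 := (hsum.hasSum.map (ContinuousLinearMap.apply ℂ (lp X 2) e)
    (ContinuousLinearMap.continuous _)).map (lp.evalCLM ℂ X 2 m) (ContinuousLinearMap.continuous _)
  have h2 := hasSum_single (f := fun n => (lp.single 2 n (k n e) : lp X 2) m) m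
    fun n hn => by simp [hn.symm]
  have h3 : (lp.single 2 m (k m e) : lp X 2) m = k m e := by simp
  rw [h3] at h2
  exact h1.unique h2

/-- The Davis–Figiel–Johnson–Pełczyński theorem. -/
theorem IsWeaklyCompactOperator.exists_reflexive_factorization {E F : Type u}
    [NormedAddCommGroup E] [NormedSpace ℂ E] [CompleteSpace E]
    [NormedAddCommGroup F] [NormedSpace ℂ F] [CompleteSpace F] {T : E →L[ℂ] F}
    (hT : IsWeaklyCompactOperator T) :
    ∃ (Y : Type u) (_ : NormedAddCommGroup Y) (_ : NormedSpace ℂ Y) (_ : CompleteSpace Y)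
      (k : E →L[ℂ] Y) (j : Y →L[ℂ] F),
      T = j.comp k ∧ IsWeaklyCompactOperator j ∧ IsReflexiveSpace Y := by
  have h2 : ∀ n : ℕ, (2 : ℂ) ^ n ≠ 0 := fun n => pow_ne_zero _ two_ne_zero
  have hsurj : ∀ n, Function.Surjective (scaledSum T n) := fun n y =>
    ⟨(0, (2 : ℂ) ^ n • y), by simp [scaledSum_apply, h2 n]⟩
  -- `X n` is `F` normed, up to equivalence, by the gauge of `2ⁿ T(B_E) + 2⁻ⁿ B_F`.
  choose X i₁ i₂ i₃ s q hsq hq hball using fun n => exists_quotient_renorming _ (hsurj n)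
  let A : ∀ n, lp X 2 →L[ℂ] F := fun n => (s n : X n →L[ℂ] F).comp (lp.evalCLM ℂ X 2 n)
  let Y : Submodule ℂ (lp X 2) := ⨅ n, (A n - A 0).ker
  have hY : ∀ x : lp X 2, x ∈ Y ↔ ∀ n, s n (x n) = s 0 (x 0) := fun x => by
    simp only [Y, Submodule.mem_iInf]
    exact forall_congr' fun n => sub_eq_zero
  have hYc : IsClosed (Y : Set (lp X 2)) := by
    simp only [Y, Submodule.coe_iInf]
    exact isClosed_iInter fun n => (A n - A 0).isClosed_ker
  have : CompleteSpace Y := hYc.completeSpace_coe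
  let j : Y →L[ℂ] F := (A 0).comp Y.subtypeL
  have hj : UltrafilterWeaklyCompact (j '' Metric.closedBall 0 1) := by
    refine UltrafilterWeaklyCompact.of_approx fun ε hε => ?_
    obtain ⟨n, hn⟩ := exists_pow_lt_of_lt_one (half_pos hε) (one_half_lt_one (α := ℝ))
    -- The extra factor `2` comes from lifts of norm at most `2`: `j(B_Y)` lies within `2 · 2⁻ⁿ` of
    -- `2ⁿ⁺¹ T(B_E)`.
    have hsm : IsWeaklyCompactOperator ((2 : ℂ) ^ (n + 1) • T) :=
      OperatorIdeal.smul_mem (U := weaklyCompactIdeal) _ hT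
    refine ⟨_, isWeaklyCompactOperator_iff.1 hsm, ?_⟩
    rintro _ ⟨x, hx, rfl⟩
    rw [mem_closedBall_zero_iff] at hx
    obtain ⟨z, hz, hzn⟩ := hball n ((x : lp X 2) n)
      ((lp.norm_apply_le_norm (by norm_num) (x : lp X 2) n).trans hx)
    have hjx : j x = (2 : ℂ) ^ n • T z.1 + ((2 : ℂ) ^ n)⁻¹ • z.2 := by
      rw [← scaledSum_apply, ← hsq, hz]
      exact ((hY x).1 x.2 n).symm
    refine ⟨(2 : ℂ) ^ n • T z.1, ⟨(2 : ℂ)⁻¹ • z.1, ?_, ?_⟩, ?_⟩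
    · rw [mem_closedBall_zero_iff, norm_smul, norm_inv, Complex.norm_ofNat]
      linarith [norm_fst_le z]
    · rw [smul_apply, map_smul, smul_smul, pow_succ, mul_assoc, mul_inv_cancel₀ two_ne_zero,
        mul_one]
    · rw [hjx, add_sub_cancel_left, norm_smul, norm_inv, norm_pow, Complex.norm_ofNat, ← inv_pow,
        ← one_div]
      calc (1 / 2 : ℝ) ^ n * ‖z.2‖ ≤ (ε / 2) * 2 :=
            mul_le_mul hn.le ((norm_snd_le z).trans hzn) (norm_nonneg _) (half_pos hε).le
        _ = ε := by ring
  -- `T e` is the image of `(2⁻ⁿ e, 0)` under `scaledSum T n`, so its norm in `X n` is at most `2⁻ⁿ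
  -- ‖e‖`.
  have hk : ∀ n, ‖((2 : ℂ) ^ n)⁻¹ • (q n).comp (ContinuousLinearMap.inl ℂ E F)‖ ≤
      (1 / 2) ^ n := fun n => by
    refine (norm_smul_le (((2 : ℂ) ^ n)⁻¹) ((q n).comp (ContinuousLinearMap.inl ℂ E F))).trans ?_
    rw [norm_inv, norm_pow, Complex.norm_ofNat, ← inv_pow, ← one_div]
    refine mul_le_of_le_one_right (by positivity)
      (ContinuousLinearMap.opNorm_le_bound _ zero_le_one fun e => ?_)
    rw [one_mul]
    refine (hq n _).trans ?_
    simp [Prod.norm_def]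
  obtain ⟨K, hK⟩ := exists_ellTwo_operator
    (fun n => ((2 : ℂ) ^ n)⁻¹ • (q n).comp (ContinuousLinearMap.inl ℂ E F))
    (Summable.of_nonneg_of_le (fun _ => norm_nonneg _) hk summable_geometric_two)
  have hsK : ∀ e n, s n (K e n) = T e := fun e n => by
    rw [hK, smul_apply, map_smul, ContinuousLinearMap.comp_apply, hsq, scaledSum_apply]
    simp [h2 n]
  refine ⟨Y, inferInstance, inferInstance, inferInstance,
    K.codRestrict Y fun e => (hY _).2 fun n => by rw [hsK, hsK], j, ?_,
    isWeaklyCompactOperator_iff.2 hj, isReflexiveSpace_of_diagonal s Y hY hj⟩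
  ext e
  exact (hsK e 0).symm

end Factorization

/-! ### Both factorization theorems -/

theorem mainTheorem2 (E F : Type u) [NormedAddCommGroup E] [NormedSpace ℂ E] [CompleteSpace E]
    [NormedAddCommGroup F] [NormedSpace ℂ F] [CompleteSpace F] (f : E → F) :
    (∀ U : OperatorIdeal.{u}, U.IsClosedIdeal → U.IsSurjectiveIdeal → U.IsFactorizableIdeal →
      (f ∈ U.holomorphicMaps E F ↔
        ∃ (G : Type u) (_ : NormedAddCommGroup G) (_ : NormedSpace ℂ G) (_ : CompleteSpace G),
          ContinuousLinearMap.id ℂ G ∈ U.comp G G ∧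
          ∃ g ∈ holomorphicMaps E G, ∃ T ∈ U.comp G F, f = T ∘ g)) ∧
    (f ∈ weaklyCompactIdeal.holomorphicMaps E F ↔
      ∃ (G : Type u) (_ : NormedAddCommGroup G) (_ : NormedSpace ℂ G) (_ : CompleteSpace G),
        IsReflexiveSpace G ∧
        ∃ g ∈ holomorphicMaps E G, ∃ T ∈ weaklyCompactIdeal.comp G F, f = T ∘ g) := by
  refine ⟨fun U hcl hsurj hfac => ⟨fun hf => ?_, ?_⟩, fun hf => ?_, ?_⟩
  · obtain ⟨G, _, _, _, g, hg, J, hJ, rfl⟩ := OperatorIdeal.exists_factorization hcl hsurj hf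
    obtain ⟨Y, _, _, _, k, j, rfl, hY⟩ := hfac G F J hJ
    refine ⟨Y, inferInstance, inferInstance, inferInstance, hY, k ∘ g,
      fun x hx => (k.analyticAt _).comp (hg x hx), j, ?_, rfl⟩
    -- `j = j ∘ I_Y` belongs to the ideal because `I_Y` does.
    simpa using OperatorIdeal.comp_left_mem j hY
  · rintro ⟨G, _, _, _, -, g, hg, T, hT, rfl⟩
    exact OperatorIdeal.comp_mem_holomorphicMaps hg hT
  · obtain ⟨G, _, _, _, g, hg, J, hJ, rfl⟩ := OperatorIdeal.exists_factorization
      weaklyCompactIdeal_isClosedIdeal weaklyCompactIdeal_isSurjectiveIdeal hf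
    obtain ⟨Y, _, _, _, k, j, rfl, hj, hY⟩ :=
      IsWeaklyCompactOperator.exists_reflexive_factorization hJ
    exact ⟨Y, inferInstance, inferInstance, inferInstance, hY, k ∘ g,
      fun x hx => (k.analyticAt _).comp (hg x hx), j, hj, rfl⟩
  · rintro ⟨G, _, _, _, -, g, hg, T, hT, rfl⟩
    exact OperatorIdeal.comp_mem_holomorphicMaps hg hT
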